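/- Work in the universe of $\mathsf{ZFA}$ (set theory with atoms, with the axiom of choice) built over a set $A=\{a_f\mid f\in\omega^\omega\}$ of atoms, where $f\mapsto a_f$ is a bijection of $\omega^\omega$ with $A$. Equip $\omega^\omega$ with the metric $d(f,g)=\frac{1}{1+\Delta(f,g)}$ for $f\ne g$, where $\Delta(f,g)=\min\{k\mid f(k)\neq g(k)\}$, and for a finite sequence $s\in\omega^n$ let $U_s$ be the set of all $f\in\omega^\omega$ extending $s$. Let $\mathscr G$ be the group of all permutations $\pi_\varphi$ of $A$ of the form $\pi_\varphi(a_f)=a_{\varphi(f)}$ with $\varphi$ an isometry of $\omega^\omega$, and let $\mathscr F$ be the normal filter of subgroups of $\mathscr G$ generated by the groups $$G_{n,F}=\{\pi_\varphi\mid \varphi(f)=f\text{ for all }f\in F,\ \varphi[U_s]=U_s\text{ for all }s\in\omega^n\},\qquad n<\omega,\ F\subseteq\omega^\omega\text{ finite}.$$ Let $M=M(A,\mathscr F,\mathscr G)$ be the permutation model consisting of all hereditarily symmetric elements of the universe: those $x$ such that $x$, its members, the members of its members, and so on, all have their stabilizer in $\mathscr G$ belonging to $\mathscr F$. Inside a model,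 a set $X$ is called C-infinite if there is a surjection from $X$ onto $\omega$, and Dedekind-infinite if there is an injection from $\omega$ into $X$. It is called H-finite if there is a colouring $c:[X]^{<\omega}\to 2$ of the finite subsets of $X$ such that for no infinite pairwise disjoint family $Y\subseteq[X]^{<\omega}$ do all unions of nonempty finite subfamilies of $Y$ have the same colour. Form 82 is the statement that the power set of every infinite set is Dedekind-infinite, and Hindman's theorem $\mathsf{HT}$ is the statement that no infinite set is H-finite. Then the following hold in $M$: 1. every infinite set is C-infinite; 2. Form 82 holds; 3. the set $A$ of atoms is infinite and H-finite; 4. $\mathsf{HT}$ fails. -/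

import Mathlib

universe u

/-! ### The universe of sets with atoms -/

/-- Codes for atoms and sets over a type `A` of atoms: a code is an atom, or a set given by a
small family of codes. -/
inductive PreZFA (A : Type u) : Type (u + 1)
  | atom : A → PreZFA A
  | mk : (ι : Type u) → (ι → PreZFA A) → PreZFA A

namespace PreZFA

variable {A : Type u}

/-- Extensional equality of codes: equal atoms, or sets with the same members. -/
def Equiv : PreZFA A → PreZFA A → Prop
  | atom a, atom b => a = b
  | mk _ f, mk _ g => (∀ i, ∃ j, Equiv (f i) (g j)) ∧ ∀ j, ∃ i, Equiv (f i) (g j)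
  | atom _, mk _ _ => False
  | mk _ _, atom _ => False

theorem Equiv.refl : ∀ x : PreZFA A, Equiv x x
  | atom _ => rfl
  | mk _ f => ⟨fun i => ⟨i, Equiv.refl (f i)⟩, fun i => ⟨i, Equiv.refl (f i)⟩⟩

theorem Equiv.symm : ∀ {x y : PreZFA A}, Equiv x y → Equiv y x
  | atom _, atom _, h => Eq.symm h
  | mk _ _, mk _ _, h =>
    ⟨fun j => (h.2 j).imp fun _ hi => hi.symm, fun i => (h.1 i).imp fun _ hj => hj.symm⟩

theorem Equiv.trans : ∀ {x y z : PreZFA A}, Equiv x y → Equiv y z → Equiv x z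
  | atom _, atom _, atom _, h, k => Eq.trans h k
  | mk _ _, mk _ _, mk _ _, h, k =>
    ⟨fun i => let ⟨j, hj⟩ := h.1 i; let ⟨l, hl⟩ := k.1 j; ⟨l, hj.trans hl⟩,
     fun l => let ⟨j, hj⟩ := k.2 l; let ⟨i, hi⟩ := h.2 j; ⟨i, hi.trans hj⟩⟩

instance setoid (A : Type u) : Setoid (PreZFA A) where
  r := Equiv
  iseqv := ⟨Equiv.refl, Equiv.symm, Equiv.trans⟩

/-- `Mem y x` says that `y` is a member of `x`; atoms have no members. -/
def Mem (y : PreZFA A) : PreZFA A → Prop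
  | atom _ => False
  | mk _ f => ∃ i, Equiv y (f i)

def IsAtom : PreZFA A → Prop
  | atom _ => True
  | mk _ _ => False

theorem mem_congr {y y' x x' : PreZFA A} (hy : Equiv y y') (hx : Equiv x x') :
    Mem y x ↔ Mem y' x' := by
  cases x <;> cases x' <;> simp only [Equiv] at hx
  · rfl
  · constructor
    · rintro ⟨i, hi⟩
      obtain ⟨j, hj⟩ := hx.1 i
      exact ⟨j, (hy.symm.trans hi).trans hj⟩
    · rintro ⟨j, hj⟩
      obtain ⟨i, hi⟩ := hx.2 j
      exact ⟨i, (hy.trans hj).trans hi.symm⟩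

theorem isAtom_congr {x x' : PreZFA A} (hx : Equiv x x') : IsAtom x ↔ IsAtom x' := by
  cases x <;> cases x' <;> simp only [Equiv] at hx <;> rfl

/-- The action of a permutation of the atoms on codes. -/
def perm (π : Equiv.Perm A) : PreZFA A → PreZFA A
  | atom a => atom (π a)
  | mk ι f => mk ι fun i => perm π (f i)

theorem perm_congr (π : Equiv.Perm A) :
    ∀ {x y : PreZFA A}, Equiv x y → Equiv (perm π x) (perm π y)
  | atom _, atom _, h => congrArg π h
  | mk _ _, mk _ _, h =>
    ⟨fun i => (h.1 i).imp fun _ hj => perm_congr π hj,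
     fun j => (h.2 j).imp fun _ hi => perm_congr π hi⟩

theorem perm_one : ∀ x : PreZFA A, perm 1 x = x
  | atom _ => rfl
  | mk ι f => congrArg (mk ι) (funext fun i => perm_one (f i))

theorem perm_mul (π ρ : Equiv.Perm A) : ∀ x : PreZFA A, perm (π * ρ) x = perm π (perm ρ x)
  | atom _ => rfl
  | mk ι f => congrArg (mk ι) (funext fun i => perm_mul π ρ (f i))

end PreZFA

/-- A structure for the language of set theory with atoms: a membership relation and a predicate
singling out the atoms. -/
class AtomStructure (M : Type*) extends Membership M M where
  IsAtom : M → Prop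

/-- The cumulative universe of sets with atoms, whose set of atoms is `A`. -/
def ZFA (A : Type u) : Type (u + 1) := Quotient (PreZFA.setoid A)

namespace ZFA

variable {A : Type u}

instance : AtomStructure (ZFA A) where
  mem x y := Quotient.liftOn₂ x y (fun x y => PreZFA.Mem y x)
    fun _ _ _ _ hx hy => propext (PreZFA.mem_congr hy hx)
  IsAtom x := Quotient.liftOn x PreZFA.IsAtom fun _ _ h => propext (PreZFA.isAtom_congr h)

/-- Permutations of the atoms act on the whole universe, by `π x = {π y | y ∈ x}` on sets. -/
instance : MulAction (Equiv.Perm A) (ZFA A) where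
  smul π := Quotient.map (PreZFA.perm π) fun _ _ h => PreZFA.perm_congr π h
  one_smul x := Quotient.inductionOn x fun x =>
    congrArg (Quotient.mk (PreZFA.setoid A)) (PreZFA.perm_one x)
  mul_smul π ρ x := Quotient.inductionOn x fun x =>
    congrArg (Quotient.mk (PreZFA.setoid A)) (PreZFA.perm_mul π ρ x)

end ZFA

/-! ### Permutation models -/

/-- A normal filter of subgroups of a group `G` of permutations of the atoms. -/
structure NormalFilter {A : Type u} (G : Subgroup (Equiv.Perm A)) where
  sets : Set (Subgroup (Equiv.Perm A))
  le_of_mem : ∀ H ∈ sets, H ≤ G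
  self_mem : G ∈ sets
  mem_of_le : ∀ H ∈ sets, ∀ K ≤ G, H ≤ K → K ∈ sets
  inf_mem : ∀ H ∈ sets, ∀ K ∈ sets, H ⊓ K ∈ sets
  conj_mem : ∀ π ∈ G, ∀ H ∈ sets, H.map (MulAut.conj π).toMonoidHom ∈ sets
  atom_mem : ∀ a : A, G ⊓ MulAction.stabilizer (Equiv.Perm A) a ∈ sets

/-- `x` is symmetric if the group of all `π ∈ G` with `π x = x` belongs to the filter. -/
def IsSymmetric {A : Type u} {G : Subgroup (Equiv.Perm A)} (F : NormalFilter G) (x : ZFA A) :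
    Prop :=
  G ⊓ MulAction.stabilizer (Equiv.Perm A) x ∈ F.sets

/-- `x` is hereditarily symmetric if it is symmetric and all its members are hereditarily
symmetric. -/
inductive IsHereditarilySymmetric {A : Type u} {G : Subgroup (Equiv.Perm A)}
    (F : NormalFilter G) : ZFA A → Prop
  | intro (x : ZFA A) : IsSymmetric F x → (∀ y ∈ x, IsHereditarilySymmetric F y) →
      IsHereditarilySymmetric F x

/-- The permutation model: the class of all hereditarily symmetric elements of the universe
(atoms included), with the membership relation and the atoms of the universe. -/
def PermutationModel {A : Type u} {G : Subgroup (Equiv.Perm A)} (F : NormalFilter G) :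
    Type (u + 1) :=
  {x : ZFA A // IsHereditarilySymmetric F x}

instance {A : Type u} {G : Subgroup (Equiv.Perm A)} (F : NormalFilter G) :
    AtomStructure (PermutationModel F) where
  mem x y := y.1 ∈ x.1
  IsAtom x := AtomStructure.IsAtom x.1

/-! ### Set-theoretic notions interpreted in a structure

All quantifiers range over the elements of the structure `M`, so that each definition is the
satisfaction in `M` of the usual first-order formula. -/

namespace Internal

variable {M : Type*} [AtomStructure M]

def IsSet (x : M) : Prop := ¬ AtomStructure.IsAtom x

/-- `x` is the set of all atoms. -/
def IsAtomSet (x : M) : Prop := IsSet x ∧ ∀ z : M, z ∈ x ↔ AtomStructure.IsAtom z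

def IsEmptySet (x : M) : Prop := IsSet x ∧ ∀ z : M, z ∉ x

/-- `x` is a set and a subset of `y`. -/
def IsSubset (x y : M) : Prop := IsSet x ∧ ∀ z : M, z ∈ x → z ∈ y

/-- `p = {x, y}` -/
def IsPair (p x y : M) : Prop := IsSet p ∧ ∀ z : M, z ∈ p ↔ z = x ∨ z = y

/-- `p = (x, y) = {{x}, {x, y}}` -/
def IsOrderedPair (p x y : M) : Prop :=
  ∃ s t : M, IsPair s x x ∧ IsPair t x y ∧ IsPair p s t

/-- `s = x ∪ {x}` -/
def IsSucc (s x : M) : Prop := IsSet s ∧ ∀ z : M, z ∈ s ↔ z ∈ x ∨ z = x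

/-- `z = ⋃ F` -/
def IsUnion (z F : M) : Prop := IsSet z ∧ ∀ u : M, u ∈ z ↔ ∃ y : M, y ∈ F ∧ u ∈ y

/-- `x` contains `∅` and is closed under `y ↦ y ∪ {y}`. -/
def IsInductive (x : M) : Prop :=
  IsSet x ∧ (∃ e : M, IsEmptySet e ∧ e ∈ x) ∧ ∀ y : M, y ∈ x → ∃ s : M, IsSucc s y ∧ s ∈ x

/-- `w = ω`, the least inductive set. -/
def IsOmega (w : M) : Prop := IsInductive w ∧ ∀ x : M, IsInductive x → IsSubset w x

/-- `t = 2 = {∅, {∅}}` -/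
def IsTwo (t : M) : Prop := ∃ e s : M, IsEmptySet e ∧ IsSucc s e ∧ IsPair t e s

/-- `(x, y) ∈ f`, that is, `f(x) = y` when `f` is a function. -/
def Maps (f x y : M) : Prop := ∃ p : M, IsOrderedPair p x y ∧ p ∈ f

/-- `f` is a function from `X` to `Y`. -/
def IsFunction (f X Y : M) : Prop :=
  IsSet f ∧ (∀ p : M, p ∈ f → ∃ x y : M, x ∈ X ∧ y ∈ Y ∧ IsOrderedPair p x y) ∧
    ∀ x : M, x ∈ X → ∃! y : M, Maps f x y

def IsInjection (f X Y : M) : Prop :=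
  IsFunction f X Y ∧ ∀ x x' y : M, Maps f x y → Maps f x' y → x = x'

def IsSurjection (f X Y : M) : Prop :=
  IsFunction f X Y ∧ ∀ y : M, y ∈ Y → ∃ x : M, Maps f x y

def IsBijection (f X Y : M) : Prop := IsInjection f X Y ∧ IsSurjection f X Y

/-- `X` is in bijection with some `n ∈ ω`. -/
def IsFinite (X : M) : Prop :=
  IsSet X ∧ ∃ w n f : M, IsOmega w ∧ n ∈ w ∧ IsBijection f X n

def IsInfinite (X : M) : Prop := IsSet X ∧ ¬ IsFinite X

/-- `P` is the power set of `X`. -/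
def IsPowerSet (P X : M) : Prop := IsSet P ∧ ∀ y : M, y ∈ P ↔ IsSubset y X

/-- `P` is the set of all finite subsets of `X`. -/
def IsFinitePowerSet (P X : M) : Prop :=
  IsSet P ∧ ∀ y : M, y ∈ P ↔ IsSubset y X ∧ IsFinite y

/-- There is an injection of `ω` into `X`. -/
def IsDedekindInfinite (X : M) : Prop := ∃ w f : M, IsOmega w ∧ IsInjection f w X

/-- There is a surjection of `X` onto `ω`. -/
def IsCInfinite (X : M) : Prop := ∃ w f : M, IsOmega w ∧ IsSurjection f X w

/-- Distinct members of `Y` have no common member. -/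
def IsPairwiseDisjoint (Y : M) : Prop :=
  ∀ y z : M, y ∈ Y → z ∈ Y → y ≠ z → ∀ u : M, ¬ (u ∈ y ∧ u ∈ z)

/-- `z` is the union of a nonempty finite subset of `Y`. -/
def IsFiniteUnion (z Y : M) : Prop :=
  ∃ F : M, IsSubset F Y ∧ IsFinite F ∧ ¬ IsEmptySet F ∧ IsUnion z F

/-- There is a colouring `c` of the finite subsets of `X` with two colours such that, for no
infinite pairwise disjoint family `Y` of finite subsets of `X`, all unions of nonempty finite
subfamilies of `Y` get the same colour. -/
def IsHFinite (X : M) : Prop :=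
  ∃ P t c : M, IsFinitePowerSet P X ∧ IsTwo t ∧ IsFunction c P t ∧
    ¬ ∃ Y : M, IsSubset Y P ∧ IsInfinite Y ∧ IsPairwiseDisjoint Y ∧
      ∃ i : M, i ∈ t ∧ ∀ z : M, IsFiniteUnion z Y → Maps c z i

/-- Form 82: the power set of every infinite set is Dedekind-infinite. -/
def Form82 (M : Type*) [AtomStructure M] : Prop :=
  ∀ X : M, IsInfinite X → ∃ P : M, IsPowerSet P X ∧ IsDedekindInfinite P

/-- Hindman's theorem: for every infinite set `X` and every colouring of its finite subsets with
two colours there is an infinite pairwise disjoint family of finite subsets of `X` all of whose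
finite unions have the same colour. -/
def HT (M : Type*) [AtomStructure M] : Prop :=
  ∀ X : M, IsInfinite X → ∀ P t c : M, IsFinitePowerSet P X → IsTwo t → IsFunction c P t →
    ∃ Y : M, IsSubset Y P ∧ IsInfinite Y ∧ IsPairwiseDisjoint Y ∧
      ∃ i : M, i ∈ t ∧ ∀ z : M, IsFiniteUnion z Y → Maps c z i

end Internal

/-! ### The group and the filter given by the isometries of Baire space -/

namespace Baire

open Classical in
/-- The metric on `ω^ω`: the distance of distinct `f`, `g` is `1 / (1 + Δ)`, where `Δ` is the
least `k` with `f k ≠ g k`. -/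
noncomputable def d (f g : ℕ → ℕ) : ℝ :=
  if f = g then 0 else 1 / (1 + (sInf {k : ℕ | f k ≠ g k} : ℕ))

def IsIsom (φ : (ℕ → ℕ) → (ℕ → ℕ)) : Prop := ∀ f g, d (φ f) (φ g) = d f g

/-- The basic open set of all `f` that extend the finite sequence `s`. -/
def U {n : ℕ} (s : Fin n → ℕ) : Set (ℕ → ℕ) := {f | ∀ i : Fin n, f i = s i}

variable {A : Type u} (a : (ℕ → ℕ) ≃ A)

/-- The permutation `π` of the atoms is induced by the map `φ`. -/
def Induces (φ : (ℕ → ℕ) → (ℕ → ℕ)) (π : Equiv.Perm A) : Prop := ∀ f, π (a f) = a (φ f)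

variable {a}

theorem Induces.one : Induces a id 1 := fun _ => rfl

theorem Induces.mul {φ ψ : (ℕ → ℕ) → (ℕ → ℕ)} {π ρ : Equiv.Perm A} (h : Induces a φ π)
    (k : Induces a ψ ρ) : Induces a (φ ∘ ψ) (π * ρ) := fun f => by
  rw [Equiv.Perm.mul_apply, k f, h (ψ f)]; rfl

theorem Induces.inv {φ : (ℕ → ℕ) → (ℕ → ℕ)} {π : Equiv.Perm A} (h : Induces a φ π) :
    ∃ ψ, Induces a ψ π⁻¹ ∧ (∀ f, ψ (φ f) = f) ∧ ∀ f, φ (ψ f) = f := by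
  refine ⟨fun f => a.symm (π⁻¹ (a f)), fun f => by simp, fun f => ?_, fun f => ?_⟩
  · simp [← h f]
  · apply a.injective
    rw [← h]; simp

theorem IsIsom.comp {φ ψ : (ℕ → ℕ) → (ℕ → ℕ)} (h : IsIsom φ) (k : IsIsom ψ) :
    IsIsom (φ ∘ ψ) := fun f g => (h _ _).trans (k f g)

theorem IsIsom.inv {φ ψ : (ℕ → ℕ) → (ℕ → ℕ)} (h : IsIsom φ) (k : ∀ f, φ (ψ f) = f) :
    IsIsom ψ := fun f g => by rw [← h, k, k]

variable (a)

/-- The group of all permutations of the atoms induced by isometries of `ω^ω`. -/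
def group : Subgroup (Equiv.Perm A) where
  carrier := {π | ∃ φ, IsIsom φ ∧ Induces a φ π}
  one_mem' := ⟨id, fun _ _ => rfl, Induces.one⟩
  mul_mem' := by
    rintro π ρ ⟨φ, hφ, h⟩ ⟨ψ, hψ, k⟩
    exact ⟨φ ∘ ψ, hφ.comp hψ, h.mul k⟩
  inv_mem' := by
    rintro π ⟨φ, hφ, h⟩
    obtain ⟨ψ, k, -, k'⟩ := h.inv
    exact ⟨ψ, hφ.inv k', k⟩

/-- The group `G_{n,F}` of all permutations induced by isometries that fix every `f ∈ F` and map
`U s` onto `U s` for every `s ∈ ω^n`. -/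
def basicGroup (n : ℕ) (F : Finset (ℕ → ℕ)) : Subgroup (Equiv.Perm A) where
  carrier := {π | ∃ φ, IsIsom φ ∧ Induces a φ π ∧ (∀ f ∈ F, φ f = f) ∧
    ∀ s : Fin n → ℕ, φ '' U s = U s}
  one_mem' := ⟨id, fun _ _ => rfl, Induces.one, fun _ _ => rfl, fun _ => Set.image_id _⟩
  mul_mem' := by
    rintro π ρ ⟨φ, hφ, h, h1, h2⟩ ⟨ψ, hψ, k, k1, k2⟩
    exact ⟨φ ∘ ψ, hφ.comp hψ, h.mul k, fun f hf => by simp [k1 f hf, h1 f hf],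
      fun s => by rw [Set.image_comp, k2, h2]⟩
  inv_mem' := by
    rintro π ⟨φ, hφ, h, h1, h2⟩
    obtain ⟨ψ, k, k', k''⟩ := h.inv
    refine ⟨ψ, hφ.inv k'', k, fun f hf => ?_, fun s => ?_⟩
    · conv_lhs => rw [← h1 f hf, k']
    · conv_lhs => rw [← h2 s, ← Set.image_comp]
      simp [k']

variable {a}

theorem agree_iff (n : ℕ) (f g : ℕ → ℕ) :
    (∀ i < n, f i = g i) ↔ d f g ≤ 1 / (1 + (n : ℝ)) := by
  unfold d
  split_ifs with h
  · subst h
    simp only [implies_true, true_iff]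
    positivity
  · have hne : {k : ℕ | f k ≠ g k}.Nonempty := by
      by_contra hc
      exact h (funext fun k => by_contra fun hk => hc ⟨k, hk⟩)
    rw [one_div_le_one_div (by positivity) (by positivity), add_le_add_iff_left, Nat.cast_le]
    constructor
    · intro hn
      by_contra hlt
      exact Nat.sInf_mem hne (hn _ (not_le.mp hlt))
    · intro hn i hi
      by_contra hne'
      exact Nat.notMem_of_lt_sInf (hi.trans_le hn) hne'

theorem IsIsom.agree {φ : (ℕ → ℕ) → (ℕ → ℕ)} (h : IsIsom φ) {n : ℕ} {f g : ℕ → ℕ} :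
    (∀ i < n, φ f i = φ g i) ↔ ∀ i < n, f i = g i := by
  rw [agree_iff, agree_iff, h]

theorem image_U_iff {n : ℕ} {φ : (ℕ → ℕ) → (ℕ → ℕ)} (hs : ∀ g, ∃ f, φ f = g) :
    (∀ s : Fin n → ℕ, φ '' U s = U s) ↔ ∀ f, ∀ i < n, φ f i = f i := by
  constructor
  · intro h f i hi
    have : φ f ∈ U fun j : Fin n => f j := by
      rw [← h]
      exact ⟨f, fun _ => rfl, rfl⟩
    exact this ⟨i, hi⟩
  · intro h s
    ext g
    constructor
    · rintro ⟨f, hf, rfl⟩ i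
      rw [h f i i.2, hf i]
    · intro hg
      obtain ⟨f, rfl⟩ := hs g
      exact ⟨f, fun i => by rw [← h f i i.2, hg i], rfl⟩

theorem mem_basicGroup_iff {n : ℕ} {F : Finset (ℕ → ℕ)} {π : Equiv.Perm A} :
    π ∈ basicGroup a n F ↔ ∃ φ, IsIsom φ ∧ Induces a φ π ∧ (∀ f ∈ F, φ f = f) ∧
      ∀ f, ∀ i < n, φ f i = f i := by
  refine exists_congr fun φ => and_congr_right fun _ => and_congr_right fun h =>
    and_congr_right fun _ => image_U_iff ?_
  obtain ⟨ψ, -, -, k⟩ := h.inv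
  exact fun g => ⟨ψ g, k g⟩

variable (a)

open Classical in
/-- The normal filter generated by the groups `G_{n,F}`, for `n < ω` and finite `F ⊆ ω^ω`. -/
def normalFilter : NormalFilter (group a) where
  sets := {H | H ≤ group a ∧ ∃ n F, basicGroup a n F ≤ H}
  le_of_mem _ h := h.1
  self_mem := ⟨le_rfl, 0, ∅, fun _ ⟨φ, hφ, h, _⟩ => ⟨φ, hφ, h⟩⟩
  mem_of_le := fun _ ⟨_, n, F, h⟩ _ hK hHK => ⟨hK, n, F, h.trans hHK⟩
  inf_mem := by
    rintro H ⟨hH, n, E, hE⟩ K ⟨-, m, F, hF⟩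
    refine ⟨inf_le_left.trans hH, max n m, E ∪ F, fun π hπ => ⟨hE ?_, hF ?_⟩⟩
    all_goals
      rw [mem_basicGroup_iff] at hπ
      refine mem_basicGroup_iff.2 ?_
      obtain ⟨φ, hφ, h, h1, h2⟩ := hπ
      refine ⟨φ, hφ, h, fun f hf => h1 f (by simp [hf]), fun f i hi => h2 f i (by simp [hi])⟩
  conj_mem := by
    rintro π hπ H ⟨hH, n, F, hF⟩
    constructor
    · rintro _ ⟨ρ, hρ, rfl⟩
      exact (group a).mul_mem ((group a).mul_mem hπ (hH hρ)) ((group a).inv_mem hπ)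
    · obtain ⟨φ, hφ, h⟩ := hπ
      obtain ⟨χ, k, k1, k2⟩ := h.inv
      refine ⟨n, F.image φ, fun ρ hρ => ⟨π⁻¹ * ρ * π, hF ?_, by simp [mul_assoc]⟩⟩
      obtain ⟨ψ, hψ, l, l1, l2⟩ := mem_basicGroup_iff.1 hρ
      refine mem_basicGroup_iff.2 ⟨(χ ∘ ψ) ∘ φ, ((hφ.inv k2).comp hψ).comp hφ, (k.mul l).mul h,
        fun f hf => ?_, fun f => ?_⟩
      · simp [l1 (φ f) (Finset.mem_image_of_mem φ hf), k1]
      · rw [← hφ.agree]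
        simpa [k2] using l2 (φ f)
  atom_mem b := by
    refine ⟨inf_le_left, 0, {a.symm b}, ?_⟩
    rintro π ⟨φ, hφ, h, h1, -⟩
    refine ⟨⟨φ, hφ, h⟩, ?_⟩
    have := h (a.symm b)
    rw [h1 _ (by simp)] at this
    simpa using this

end Baire

/-- The permutation model `M(A, 𝓕, 𝓖)` given by the bijection `f ↦ a f` of `ω^ω` with the set
`A` of atoms. -/
def IsometryModel {A : Type u} (a : (ℕ → ℕ) ≃ A) : Type (u + 1) :=
  PermutationModel (Baire.normalFilter a)

instance {A : Type u} (a : (ℕ → ℕ) ≃ A) : AtomStructure (IsometryModel a) :=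
  inferInstanceAs (AtomStructure (PermutationModel (Baire.normalFilter a)))

/-! Sets of the model are exactly the small symmetric collections of its elements, so finiteness,
numerals and functions inside it can be computed outside (`exists_set`, `exists_function`,
`isFinite_iff`).

Statements 1 and 2 rest on one fact about supports. Let `X` be invariant under `G_{n,F}`, and
suppose every `G_{m,E}` with `n ≤ m`, `F ⊆ E` has only finitely many orbits on `X`. Then `X` is
finite (`finite_of_fewOrbits`). A support point `e` outside `F` is superfluous: elements of
`G_{m,E}` can give `e` infinitely many values at place `m`, so by pigeonhole some element fixes the
given member of `X` while moving `e` at place `m`; together with the stabilizer of `e` this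
generates all of `G_{m,E}` (`fixed_of_fewOrbits`). Hence each member of `X` is fixed by some
`G_{m,F}`. As `G_{m,F}` is normal in `G_{n,F}` and there are finitely many orbits, one `m` serves
for all of `X`, and the orbits of that `G_{m,F}` on `X` are singletons. So on an infinite set some
`G_{m,E}` has infinitely many orbits. Numbering orbits gives a symmetric surjection onto `ω`, and
its fibres are distinct subsets of `X`.

For the atoms, colour a pair by the parity of the first difference `Δ` of its indices, which
isometries preserve. An infinite disjoint family of finite sets of atoms has a member with an atom
outside the family's support; moving that atom slightly, with the rest of the member fixed, would
break disjointness unless the member is a singleton (`exists_ball_of_disjoint`). So the family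
contains all singletons from some ball, whose pairwise unions realise both parities. -/

namespace ZFA

/-! ### Sets, atoms and permutations in the full universe. -/

variable {A : Type u}

open AtomStructure

/-- The atom `a` as an element of the universe. -/
def atom (a : A) : ZFA A := Quotient.mk (PreZFA.setoid A) (PreZFA.atom a)

theorem atom_injective : Function.Injective (atom : A → ZFA A) := fun _ _ h => Quotient.exact h

theorem isAtom_atom (a : A) : IsAtom (atom a) := trivial

theorem isAtom_iff {x : ZFA A} : IsAtom x ↔ ∃ a, x = atom a := by
  constructor
  · refine Quotient.inductionOn x fun x h => ?_
    cases x with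
    | atom a => exact ⟨a, rfl⟩
    | mk ι f => exact h.elim
  · rintro ⟨a, rfl⟩
    exact isAtom_atom a

theorem notMem_atom (a : A) (x : ZFA A) : x ∉ atom a :=
  Quotient.inductionOn x fun _ h => h

/-- Every set of the universe is the range of a small family. -/
theorem exists_family {x : ZFA A} (hx : ¬ IsAtom x) :
    ∃ (ι : Type u) (f : ι → ZFA A), ∀ y, y ∈ x ↔ ∃ i, y = f i := by
  revert hx
  refine Quotient.inductionOn x fun x hx => ?_
  cases x with
  | atom a => exact (hx trivial).elim
  | mk ι f =>
    refine ⟨ι, fun i => Quotient.mk _ (f i), fun y => Quotient.inductionOn y fun y => ?_⟩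
    exact exists_congr fun i => ⟨fun h => Quotient.sound h, fun h => Quotient.exact h⟩

instance small_mem (x : ZFA A) : Small.{u} {y // y ∈ x} := by
  by_cases hx : IsAtom x
  · obtain ⟨a, rfl⟩ := isAtom_iff.1 hx
    have : IsEmpty {y // y ∈ atom a} := ⟨fun y => notMem_atom a _ y.2⟩
    infer_instance
  · obtain ⟨ι, f, h⟩ := exists_family hx
    exact small_of_surjective (f := fun i : ι => (⟨f i, (h _).2 ⟨i, rfl⟩⟩ : {y // y ∈ x}))
      fun y => ((h _).1 y.2).imp fun _ hi => Subtype.ext hi.symm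

/-- Every small class of elements of the universe is a set. -/
theorem exists_set (S : Set (ZFA A)) [Small.{u} S] :
    ∃ x : ZFA A, ¬ IsAtom x ∧ ∀ y, y ∈ x ↔ y ∈ S := by
  refine ⟨Quotient.mk _ (PreZFA.mk (Shrink.{u} S)
    fun i => Quotient.out ((equivShrink S).symm i : ZFA A)), fun h => h, fun y => ?_⟩
  refine Quotient.inductionOn y fun y => ?_
  constructor
  · rintro ⟨i, hi⟩
    have := Quotient.sound (s := PreZFA.setoid A) hi
    rw [this.trans (Quotient.out_eq _)]
    exact Subtype.coe_prop _
  · intro hy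
    refine ⟨equivShrink S ⟨_, hy⟩, ?_⟩
    apply Quotient.exact (s := PreZFA.setoid A)
    refine Eq.symm ((Quotient.out_eq _).trans ?_)
    rw [Equiv.symm_apply_apply]

theorem ext {x y : ZFA A} (hx : ¬ IsAtom x) (hy : ¬ IsAtom y) (h : ∀ z, z ∈ x ↔ z ∈ y) :
    x = y := by
  revert hx hy h
  refine Quotient.inductionOn₂ x y fun x y hx hy h => ?_
  cases x with
  | atom a => exact (hx trivial).elim
  | mk ι f =>
    cases y with
    | atom a => exact (hy trivial).elim
    | mk κ g =>
      refine Quotient.sound ⟨fun i => (h (Quotient.mk _ (f i))).1 ⟨i, PreZFA.Equiv.refl _⟩,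
        fun j => ?_⟩
      obtain ⟨i, hi⟩ := (h (Quotient.mk _ (g j))).2 ⟨j, PreZFA.Equiv.refl _⟩
      exact ⟨i, hi.symm⟩

theorem smul_atom (π : Equiv.Perm A) (a : A) : π • atom a = atom (π a) := rfl

theorem smul_mem_smul (π : Equiv.Perm A) {x y : ZFA A} (h : y ∈ x) : π • y ∈ π • x := by
  revert h
  refine Quotient.inductionOn₂ x y fun x y h => ?_
  cases x with
  | atom a => exact h.elim
  | mk ι f => exact h.imp fun i hi => PreZFA.perm_congr π hi

theorem smul_mem_smul_iff (π : Equiv.Perm A) {x y : ZFA A} : π • y ∈ π • x ↔ y ∈ x :=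
  ⟨fun h => by simpa using smul_mem_smul π⁻¹ h, smul_mem_smul π⟩

theorem isAtom_smul_iff (π : Equiv.Perm A) {x : ZFA A} : IsAtom (π • x) ↔ IsAtom x := by
  refine Quotient.inductionOn x fun x => ?_
  cases x <;> exact Iff.rfl

end ZFA

/-- The stabilizer of `π • x` contains the conjugate by `π` of the stabilizer of `x`, so normality
of the filter suffices. -/
theorem IsHereditarilySymmetric.smul {A : Type u} {G : Subgroup (Equiv.Perm A)}
    {F : NormalFilter G} {x : ZFA A} (hx : IsHereditarilySymmetric F x) {π : Equiv.Perm A}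
    (hπ : π ∈ G) : IsHereditarilySymmetric F (π • x) := by
  induction hx with
  | intro x hx _ ih =>
    refine .intro _ (F.mem_of_le _ (F.conj_mem π hπ _ hx) _ inf_le_left ?_) fun y hy => ?_
    · rintro _ ⟨ρ, ⟨hρ, hρx⟩, rfl⟩
      refine ⟨G.mul_mem (G.mul_mem hπ hρ) (G.inv_mem hπ), ?_⟩
      have hρx' : ρ • x = x := hρx
      change (π * ρ * π⁻¹) • π • x = π • x
      rw [mul_smul, mul_smul, inv_smul_smul, hρx']
    · have h := ih (π⁻¹ • y) (by simpa using ZFA.smul_mem_smul π⁻¹ hy)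
      rwa [smul_inv_smul] at h

/-! ### The permutation model: extensionality and symmetric comprehension. -/

namespace PermutationModel

open AtomStructure Internal

variable {A : Type u} {G : Subgroup (Equiv.Perm A)} {F : NormalFilter G}

instance : MulAction G (PermutationModel F) where
  smul π x := ⟨(π : Equiv.Perm A) • x.1, x.2.smul π.2⟩
  one_smul x := Subtype.ext (one_smul _ x.1)
  mul_smul π ρ x := Subtype.ext (mul_smul (π : Equiv.Perm A) (ρ : Equiv.Perm A) x.1)

theorem val_injective : Function.Injective (Subtype.val : PermutationModel F → ZFA A) :=
  Subtype.val_injective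

theorem smul_mem_smul_iff (π : G) {x y : PermutationModel F} : π • y ∈ π • x ↔ y ∈ x :=
  ZFA.smul_mem_smul_iff (π : Equiv.Perm A)

theorem mem_smul_iff (π : G) {x y : PermutationModel F} : y ∈ π • x ↔ π⁻¹ • y ∈ x := by
  rw [← smul_mem_smul_iff π (y := π⁻¹ • y), smul_inv_smul]

theorem isAtom_smul_iff (π : G) {x : PermutationModel F} : IsAtom (π • x) ↔ IsAtom x :=
  ZFA.isAtom_smul_iff (π : Equiv.Perm A)

theorem isSet_smul_iff (π : G) {x : PermutationModel F} : IsSet (π • x) ↔ IsSet x :=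
  not_congr (isAtom_smul_iff π)

theorem hereditarilySymmetric_of_mem {x y : ZFA A} (hx : IsHereditarilySymmetric F x)
    (h : y ∈ x) : IsHereditarilySymmetric F y := by
  cases hx with
  | intro _ _ h' => exact h' y h

/-- The model is a transitive class, so it inherits extensionality from the universe. -/
theorem ext {x y : PermutationModel F} (hx : IsSet x) (hy : IsSet y)
    (h : ∀ z, z ∈ x ↔ z ∈ y) : x = y :=
  Subtype.ext <| ZFA.ext hx hy fun z =>
    ⟨fun hz => (h ⟨z, hereditarilySymmetric_of_mem x.2 hz⟩).1 hz,
      fun hz => (h ⟨z, hereditarilySymmetric_of_mem y.2 hz⟩).2 hz⟩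

theorem exists_stabilizer (x : PermutationModel F) :
    ∃ H ∈ F.sets, ∀ π : G, (π : Equiv.Perm A) ∈ H → π • x = x := by
  cases x.2 with
  | intro _ h _ => exact ⟨_, h, fun π hπ => Subtype.ext hπ.2⟩

instance small_mem (x : PermutationModel F) : Small.{u} {y // y ∈ x} :=
  small_of_injective (β := {y // y ∈ x.1})
    (f := fun y : {y // y ∈ x} => (⟨y.1.1, y.2⟩ : {y // y ∈ x.1}))
    fun _ _ h => Subtype.ext (val_injective (congrArg (fun z : {y // y ∈ x.1} => z.1) h))

/-- Every small symmetric class of elements of the model is a set of the model. -/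
theorem exists_set (S : Set (PermutationModel F)) [Small.{u} S] {H : Subgroup (Equiv.Perm A)}
    (hH : H ∈ F.sets) (hS : ∀ π : G, (π : Equiv.Perm A) ∈ H → ∀ x ∈ S, π • x ∈ S) :
    ∃ x : PermutationModel F, IsSet x ∧ ∀ y, y ∈ x ↔ y ∈ S := by
  have : Small.{u} (Subtype.val '' S : Set (ZFA A)) :=
    small_of_surjective (f := fun x : S => (⟨x.1.1, x.1, x.2, rfl⟩ : (Subtype.val '' S : Set _)))
      fun ⟨_, x, hx, h⟩ => ⟨⟨x, hx⟩, Subtype.ext h⟩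
  obtain ⟨x, hx, hxS⟩ := ZFA.exists_set (Subtype.val '' S)
  have hsub : ∀ π ∈ H, ∀ y ∈ x, π • y ∈ x := by
    intro π hπ y hy
    obtain ⟨z, hz, rfl⟩ := (hxS y).1 hy
    exact (hxS _).2 ⟨_, hS ⟨π, F.le_of_mem H hH hπ⟩ hπ z hz, rfl⟩
  have hx' : IsHereditarilySymmetric F x := by
    refine .intro x (F.mem_of_le H hH _ inf_le_left fun π hπ => ⟨F.le_of_mem H hH hπ, ?_⟩) ?_
    · refine ZFA.ext (mt (ZFA.isAtom_smul_iff π).1 hx) hx fun y => ?_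
      rw [← smul_inv_smul π y, ZFA.smul_mem_smul_iff]
      refine ⟨hsub π hπ _, fun h => ?_⟩
      simpa using hsub π⁻¹ (H.inv_mem hπ) _ h
    · intro y hy
      obtain ⟨z, -, rfl⟩ := (hxS y).1 hy
      exact z.2
  refine ⟨⟨x, hx'⟩, hx, fun y => (hxS y.1).trans ?_⟩
  exact ⟨fun ⟨z, hz, h⟩ => Subtype.ext h ▸ hz, fun h => ⟨y, h, rfl⟩⟩

theorem smul_mem_of_smul_eq {x : PermutationModel F} {π : G} (h : π • x = x) {y : PermutationModel F}
    (hy : y ∈ x) : π • y ∈ x := by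
  rw [← h]
  exact (smul_mem_smul_iff π).2 hy

/-! ### Pairs -/

theorem exists_pair (x y : PermutationModel F) : ∃ p, IsPair p x y := by
  obtain ⟨H, hH, hx⟩ := exists_stabilizer x
  obtain ⟨K, hK, hy⟩ := exists_stabilizer y
  refine exists_set {x, y} (F.inf_mem H hH K hK) ?_
  rintro π ⟨hπ, hπ'⟩ z (rfl | rfl)
  · exact .inl (hx π hπ)
  · exact .inr (hy π hπ')

/-- The unordered pair `{x, y}` in the model. -/
noncomputable def pair (x y : PermutationModel F) : PermutationModel F := (exists_pair x y).choose

theorem isPair_pair (x y : PermutationModel F) : IsPair (pair x y) x y :=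
  (exists_pair x y).choose_spec

theorem mem_pair {x y z : PermutationModel F} : z ∈ pair x y ↔ z = x ∨ z = y :=
  (isPair_pair x y).2 z

theorem isPair_iff {p x y : PermutationModel F} : IsPair p x y ↔ p = pair x y := by
  constructor
  · exact fun h => ext h.1 (isPair_pair x y).1 fun z => (h.2 z).trans mem_pair.symm
  · rintro rfl
    exact isPair_pair x y

theorem smul_pair (π : G) (x y : PermutationModel F) : π • pair x y = pair (π • x) (π • y) := by
  refine ext ((isSet_smul_iff π).2 (isPair_pair x y).1) (isPair_pair _ _).1 fun z => ?_
  rw [mem_smul_iff, mem_pair, mem_pair, inv_smul_eq_iff, inv_smul_eq_iff]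

theorem pair_inj {x y x' y' : PermutationModel F} (h : pair x y = pair x' y') :
    x = x' ∧ y = y' ∨ x = y' ∧ y = x' := by
  have h1 : x ∈ pair x' y' := h ▸ mem_pair.2 (.inl rfl)
  have h2 : y ∈ pair x' y' := h ▸ mem_pair.2 (.inr rfl)
  have h3 : x' ∈ pair x y := h ▸ mem_pair.2 (.inl rfl)
  have h4 : y' ∈ pair x y := h ▸ mem_pair.2 (.inr rfl)
  rw [mem_pair] at h1 h2 h3 h4
  grind

/-- The ordered pair `(x, y)` in the model. -/
noncomputable def opair (x y : PermutationModel F) : PermutationModel F :=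
  pair (pair x x) (pair x y)

theorem isOrderedPair_iff {p x y : PermutationModel F} : IsOrderedPair p x y ↔ p = opair x y := by
  simp only [IsOrderedPair, isPair_iff]
  exact ⟨fun ⟨s, t, hs, ht, hp⟩ => by rw [hp, hs, ht, opair], fun h => ⟨_, _, rfl, rfl, h⟩⟩

theorem opair_inj {x y x' y' : PermutationModel F} :
    opair x y = opair x' y' ↔ x = x' ∧ y = y' := by
  constructor
  · intro h
    rcases pair_inj h with ⟨h1, h2⟩ | ⟨h1, h2⟩ <;> rcases pair_inj h1 with h1 | h1 <;>
      rcases pair_inj h2 with h2 | h2 <;> grind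
  · rintro ⟨rfl, rfl⟩
    rfl

theorem smul_opair (π : G) (x y : PermutationModel F) : π • opair x y = opair (π • x) (π • y) := by
  simp only [opair, smul_pair]

theorem maps_iff {f x y : PermutationModel F} : Maps f x y ↔ opair x y ∈ f := by
  simp only [Maps, isOrderedPair_iff]
  exact ⟨fun ⟨p, hp, h⟩ => hp ▸ h, fun h => ⟨_, rfl, h⟩⟩

/-! ### Functions -/

/-- A symmetric map from a set to a set is a function of the model. -/
theorem exists_function {X Y : PermutationModel F} (φ : PermutationModel F → PermutationModel F)
    (hφ : ∀ x ∈ X, φ x ∈ Y) {H : Subgroup (Equiv.Perm A)} (hH : H ∈ F.sets)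
    (hX : ∀ π : G, (π : Equiv.Perm A) ∈ H → ∀ x ∈ X, π • x ∈ X)
    (hφH : ∀ π : G, (π : Equiv.Perm A) ∈ H → ∀ x ∈ X, φ (π • x) = π • φ x) :
    ∃ f, IsFunction f X Y ∧ ∀ x y, Maps f x y ↔ x ∈ X ∧ y = φ x := by
  have : Small.{u} ((fun x => opair x (φ x)) '' {x | x ∈ X}) :=
    have : Small.{u} {x | x ∈ X} := small_mem X
    inferInstance
  obtain ⟨f, hf, hfm⟩ := exists_set ((fun x => opair x (φ x)) '' {x | x ∈ X}) hH (by
    rintro π hπ _ ⟨x, hx, rfl⟩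
    refine ⟨π • x, hX π hπ x hx, ?_⟩
    simp only [smul_opair, hφH π hπ x hx])
  have hmaps : ∀ x y, Maps f x y ↔ x ∈ X ∧ y = φ x := by
    intro x y
    rw [maps_iff, hfm]
    constructor
    · rintro ⟨z, hz, h⟩
      obtain ⟨rfl, rfl⟩ := opair_inj.1 h
      exact ⟨hz, rfl⟩
    · rintro ⟨hx, rfl⟩
      exact ⟨x, hx, rfl⟩
  refine ⟨f, ⟨hf, fun p hp => ?_, fun x hx => ⟨φ x, (hmaps _ _).2 ⟨hx, rfl⟩, fun y hy => ?_⟩⟩,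
    hmaps⟩
  · obtain ⟨x, hx, rfl⟩ := (hfm p).1 hp
    exact ⟨x, φ x, hx, hφ x hx, isOrderedPair_iff.2 rfl⟩
  · exact ((hmaps _ _).1 hy).2

theorem _root_.Internal.IsFunction.mem {f X Y x y : PermutationModel F} (hf : IsFunction f X Y)
    (h : Maps f x y) : x ∈ X ∧ y ∈ Y := by
  obtain ⟨p, hp, hpf⟩ := h
  obtain ⟨x', y', hx, hy, hp'⟩ := hf.2.1 p hpf
  rw [isOrderedPair_iff] at hp hp'
  obtain ⟨rfl, rfl⟩ := opair_inj.1 (hp.symm.trans hp')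
  exact ⟨hx, hy⟩

/-! ### Natural numbers -/

theorem exists_empty : ∃ x : PermutationModel F, IsEmptySet x := by
  obtain ⟨x, hx, h⟩ := exists_set (∅ : Set (PermutationModel F)) F.self_mem (by simp)
  exact ⟨x, hx, fun z hz => (h z).1 hz⟩

theorem exists_succ (x : PermutationModel F) : ∃ s, IsSucc s x := by
  obtain ⟨H, hH, hx⟩ := exists_stabilizer x
  have : Small.{u} ({y | y ∈ x} ∪ {x} : Set (PermutationModel F)) :=
    have : Small.{u} {y | y ∈ x} := small_mem x
    inferInstance
  refine exists_set ({y | y ∈ x} ∪ {x}) hH ?_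
  rintro π hπ y (hy | rfl)
  · exact .inl (smul_mem_of_smul_eq (hx π hπ) hy)
  · exact .inr (hx π hπ)

/-- The von Neumann numeral `k` in the model. -/
noncomputable def nat : ℕ → PermutationModel F
  | 0 => exists_empty.choose
  | k + 1 => (exists_succ (nat k)).choose

theorem isEmptySet_nat_zero : IsEmptySet (nat 0 : PermutationModel F) := exists_empty.choose_spec

theorem isSucc_nat_succ (k : ℕ) : IsSucc (nat (k + 1) : PermutationModel F) (nat k) :=
  (exists_succ (nat k)).choose_spec

theorem isSet_nat : ∀ k, IsSet (nat k : PermutationModel F)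
  | 0 => isEmptySet_nat_zero.1
  | k + 1 => (isSucc_nat_succ k).1

theorem eq_nat_zero {x : PermutationModel F} (h : IsEmptySet x) : x = nat 0 :=
  ext h.1 (isSet_nat 0) fun z => iff_of_false (h.2 z) (isEmptySet_nat_zero.2 z)

theorem eq_nat_succ {x : PermutationModel F} {k : ℕ} (h : IsSucc x (nat k)) : x = nat (k + 1) :=
  ext h.1 (isSet_nat _) fun z => (h.2 z).trans ((isSucc_nat_succ k).2 z).symm

theorem mem_nat {x : PermutationModel F} : ∀ {k : ℕ}, x ∈ (nat k : PermutationModel F) ↔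
    ∃ j < k, x = nat j
  | 0 => iff_of_false (isEmptySet_nat_zero.2 x) (by simp)
  | k + 1 => by
    rw [(isSucc_nat_succ k).2, mem_nat]
    constructor
    · rintro (⟨j, hj, rfl⟩ | rfl)
      · exact ⟨j, by omega, rfl⟩
      · exact ⟨k, by omega, rfl⟩
    · rintro ⟨j, hj, rfl⟩
      rcases Nat.lt_succ_iff_lt_or_eq.1 hj with hj | rfl
      · exact .inl ⟨j, hj, rfl⟩
      · exact .inr rfl

/-- Self-membership would identify `nat k` with an earlier numeral, which would then be a member of
itself. -/
theorem nat_notMem_nat (k : ℕ) : (nat k : PermutationModel F) ∉ (nat k : PermutationModel F) := by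
  induction k using Nat.strong_induction_on with
  | _ k ih =>
    intro h
    obtain ⟨j, hj, hkj⟩ := mem_nat.1 h
    have hjk : (nat j : PermutationModel F) ∈ (nat k : PermutationModel F) :=
      mem_nat.2 ⟨j, hj, rfl⟩
    rw [hkj] at hjk
    exact ih j hj hjk

theorem nat_injective : Function.Injective (nat : ℕ → PermutationModel F) := by
  intro i j h
  rcases lt_trichotomy i j with hij | hij | hij
  · exact (nat_notMem_nat j (mem_nat.2 ⟨i, hij, h.symm⟩)).elim
  · exact hij
  · exact (nat_notMem_nat i (mem_nat.2 ⟨j, hij, h⟩)).elim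

theorem smul_nat (π : G) : ∀ k, π • (nat k : PermutationModel F) = nat k
  | 0 => eq_nat_zero ⟨(isSet_smul_iff π).2 (isSet_nat 0), fun z hz =>
      isEmptySet_nat_zero.2 _ ((mem_smul_iff π).1 hz)⟩
  | k + 1 => eq_nat_succ ⟨(isSet_smul_iff π).2 (isSet_nat _), fun z => by
      rw [mem_smul_iff, (isSucc_nat_succ k).2, ← smul_mem_smul_iff π, smul_inv_smul,
        inv_smul_eq_iff, smul_nat π k]⟩

theorem exists_omega : ∃ w : PermutationModel F, IsSet w ∧ ∀ z, z ∈ w ↔ ∃ k, z = nat k := by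
  obtain ⟨w, hw, h⟩ := exists_set (Set.range (nat : ℕ → PermutationModel F)) F.self_mem (by
    rintro π - _ ⟨k, rfl⟩
    exact ⟨k, (smul_nat π k).symm⟩)
  exact ⟨w, hw, fun z => (h z).trans (exists_congr fun k => eq_comm)⟩

/-- The set `ω` of the model. -/
noncomputable def omega : PermutationModel F := exists_omega.choose

theorem mem_omega {z : PermutationModel F} : z ∈ (omega : PermutationModel F) ↔ ∃ k, z = nat k :=
  exists_omega.choose_spec.2 z

theorem isInductive_omega : IsInductive (omega : PermutationModel F) := by
  refine ⟨exists_omega.choose_spec.1, ⟨nat 0, isEmptySet_nat_zero, mem_omega.2 ⟨0, rfl⟩⟩,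
    fun y hy => ?_⟩
  obtain ⟨k, rfl⟩ := mem_omega.1 hy
  exact ⟨nat (k + 1), isSucc_nat_succ k, mem_omega.2 ⟨_, rfl⟩⟩

theorem nat_mem_of_isInductive {x : PermutationModel F} (hx : IsInductive x) : ∀ k, nat k ∈ x
  | 0 => by
    obtain ⟨e, he, hex⟩ := hx.2.1
    rwa [← eq_nat_zero he]
  | k + 1 => by
    obtain ⟨s, hs, hsx⟩ := hx.2.2 _ (nat_mem_of_isInductive hx k)
    rwa [← eq_nat_succ hs]

theorem isOmega_omega : IsOmega (omega : PermutationModel F) := by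
  refine ⟨isInductive_omega, fun x hx => ⟨isInductive_omega.1, fun z hz => ?_⟩⟩
  obtain ⟨k, rfl⟩ := mem_omega.1 hz
  exact nat_mem_of_isInductive hx k

theorem isTwo_nat : IsTwo (pair (nat 0) (nat 1) : PermutationModel F) :=
  ⟨nat 0, nat 1, isEmptySet_nat_zero, isSucc_nat_succ 0, isPair_pair _ _⟩

/-! ### Finite sets -/

/-- A finite set of elements of the model is fixed pointwise by a group in the filter. -/
theorem exists_pointwise_stabilizer {S : Set (PermutationModel F)} (hS : S.Finite) :
    ∃ H ∈ F.sets, ∀ π : G, (π : Equiv.Perm A) ∈ H → ∀ x ∈ S, π • x = x := by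
  induction S, hS using Set.Finite.induction_on with
  | empty => exact ⟨G, F.self_mem, by simp⟩
  | @insert x S _ _ ih =>
    obtain ⟨H, hH, h⟩ := ih
    obtain ⟨K, hK, k⟩ := exists_stabilizer x
    refine ⟨H ⊓ K, F.inf_mem H hH K hK, ?_⟩
    rintro π ⟨hπ, hπ'⟩ y (rfl | hy)
    · exact k π hπ'
    · exact h π hπ y hy

/-- Finiteness is absolute: a group in the filter fixes finitely many elements pointwise, so any
external bijection with a numeral is symmetric. -/
theorem isFinite_iff {X : PermutationModel F} : IsFinite X ↔ IsSet X ∧ {x | x ∈ X}.Finite := by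
  refine and_congr_right fun hX => ?_
  constructor
  · rintro ⟨w, n, f, hw, hn, hf⟩
    -- Leastness puts the internal `ω` inside `omega`, so `n` is a standard numeral.
    obtain ⟨k, rfl⟩ := mem_omega.1 ((hw.2 omega isInductive_omega).2 n hn)
    have h1 : ∀ x ∈ X, ∃ j < k, Maps f x (nat j) := by
      intro x hx
      obtain ⟨y, hy, -⟩ := hf.1.1.2.2 x hx
      obtain ⟨j, hj, rfl⟩ := mem_nat.1 (hf.1.1.mem hy).2
      exact ⟨j, hj, hy⟩
    choose! θ hθ hf' using h1
    refine Set.Finite.of_finite_image ((Set.finite_lt_nat k).subset (t := θ '' {x | x ∈ X}) ?_) ?_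
    · rintro _ ⟨x, hx, rfl⟩
      exact hθ x hx
    · intro x hx y hy hxy
      refine hf.1.2 x y _ (hf' x hx) ?_
      rw [hxy]
      exact hf' y hy
  · intro hfin
    obtain ⟨H, hH, h⟩ := exists_pointwise_stabilizer hfin
    have := hfin.to_subtype
    obtain ⟨k, ⟨e⟩⟩ := Finite.exists_equiv_fin {x | x ∈ X}
    classical
    let φ : PermutationModel F → PermutationModel F := fun x =>
      if hx : x ∈ X then nat (e ⟨x, hx⟩) else x
    have hφ : ∀ x (hx : x ∈ X), φ x = nat (e ⟨x, hx⟩) := fun x hx => dif_pos hx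
    obtain ⟨f, hf, hfm⟩ := exists_function (X := X) (Y := nat k) φ
      (fun x hx => by rw [hφ x hx]; exact mem_nat.2 ⟨_, (e ⟨x, hx⟩).2, rfl⟩) hH
      (fun π hπ x hx => by rwa [h π hπ x hx])
      (fun π hπ x hx => by rw [h π hπ x hx, hφ x hx, smul_nat])
    refine ⟨omega, nat k, f, isOmega_omega, mem_omega.2 ⟨k, rfl⟩, ⟨hf, ?_⟩, hf, ?_⟩
    · intro x x' y hx hx'
      rw [hfm] at hx hx'
      obtain ⟨hx, rfl⟩ := hx
      obtain ⟨hx', h'⟩ := hx'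
      rw [hφ x hx, hφ x' hx'] at h'
      exact congrArg Subtype.val (e.injective (Fin.ext (nat_injective h')))
    · intro y hy
      obtain ⟨j, hj, rfl⟩ := mem_nat.1 hy
      refine ⟨e.symm ⟨j, hj⟩, (hfm _ _).2 ⟨(e.symm ⟨j, hj⟩).2, ?_⟩⟩
      rw [hφ _ (e.symm ⟨j, hj⟩).2]
      simp

theorem isInfinite_iff {X : PermutationModel F} :
    IsInfinite X ↔ IsSet X ∧ {x | x ∈ X}.Infinite := by
  rw [IsInfinite, isFinite_iff]
  exact and_congr_right fun hX => not_congr (and_iff_right hX)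

theorem isSubset_smul_iff (π : G) {x y : PermutationModel F} :
    IsSubset (π • x) (π • y) ↔ IsSubset x y := by
  refine and_congr (isSet_smul_iff π) ⟨fun h z hz => ?_, fun h z hz => ?_⟩
  · exact (smul_mem_smul_iff π).1 (h _ ((smul_mem_smul_iff π).2 hz))
  · exact (mem_smul_iff π).2 (h _ ((mem_smul_iff π).1 hz))

theorem isFinite_smul_iff (π : G) {x : PermutationModel F} : IsFinite (π • x) ↔ IsFinite x := by
  rw [isFinite_iff, isFinite_iff, isSet_smul_iff]
  have : {z | z ∈ π • x} = (fun z => π • z) '' {z | z ∈ x} := by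
    ext z
    constructor
    · exact fun hz => ⟨π⁻¹ • z, (mem_smul_iff π).1 hz, smul_inv_smul π z⟩
    · rintro ⟨z, hz, rfl⟩
      exact (smul_mem_smul_iff π).2 hz
  rw [this, Set.finite_image_iff (MulAction.injective π).injOn]

instance small_isSubset (X : PermutationModel F) : Small.{u} {y | IsSubset y X} :=
  small_of_injective (β := Set {z // z ∈ X}) (f := fun y => {z | z.1 ∈ y.1}) fun y y' h =>
    Subtype.ext <| ext y.2.1 y'.2.1 fun z =>
      ⟨fun hz => ((Set.ext_iff.1 h) ⟨z, y.2.2 z hz⟩).1 hz,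
        fun hz => ((Set.ext_iff.1 h) ⟨z, y'.2.2 z hz⟩).2 hz⟩

theorem exists_powerSet (X : PermutationModel F) : ∃ P, IsPowerSet P X := by
  obtain ⟨H, hH, h⟩ := exists_stabilizer X
  refine exists_set {y | IsSubset y X} hH fun π hπ y hy => ?_
  have := (isSubset_smul_iff π).2 hy
  rwa [h π hπ] at this

theorem exists_finitePowerSet (X : PermutationModel F) : ∃ P, IsFinitePowerSet P X := by
  obtain ⟨H, hH, h⟩ := exists_stabilizer X
  have : Small.{u} {y | IsSubset y X ∧ IsFinite y} :=
    small_subset.{u} (s := {y | IsSubset y X}) (t := {y | IsSubset y X ∧ IsFinite y}) fun y hy => hy.1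
  refine exists_set {y | IsSubset y X ∧ IsFinite y} hH fun π hπ y hy => ?_
  have := (isSubset_smul_iff π).2 hy.1
  rw [h π hπ] at this
  exact ⟨this, (isFinite_smul_iff π).2 hy.2⟩

/-! ### Atoms -/

theorem hereditarilySymmetric_atom (b : A) : IsHereditarilySymmetric F (ZFA.atom b) := by
  refine .intro _ (F.mem_of_le _ (F.atom_mem b) _ inf_le_left ?_)
    fun y hy => (ZFA.notMem_atom b y hy).elim
  rintro π ⟨hπ, hb⟩
  exact ⟨hπ, congrArg ZFA.atom hb⟩

variable (F) in
/-- The atom `b` as an element of the model. -/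
def atom (b : A) : PermutationModel F := ⟨ZFA.atom b, hereditarilySymmetric_atom b⟩

theorem atom_injective : Function.Injective (atom F) := fun _ _ h =>
  ZFA.atom_injective (congrArg Subtype.val h)

theorem isAtom_iff {x : PermutationModel F} : IsAtom x ↔ ∃ b, x = atom F b :=
  ZFA.isAtom_iff.trans (exists_congr fun b => val_injective.eq_iff (b := atom F b))

theorem smul_atom (π : G) (b : A) : π • atom F b = atom F ((π : Equiv.Perm A) b) := rfl

theorem exists_atomSet : ∃ S : PermutationModel F, IsAtomSet S := by
  obtain ⟨S, hS, h⟩ := exists_set (Set.range (atom F)) F.self_mem (by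
    rintro π - _ ⟨b, rfl⟩
    exact ⟨_, rfl⟩)
  refine ⟨S, hS, fun z => (h z).trans ?_⟩
  rw [isAtom_iff]
  exact exists_congr fun b => eq_comm

end PermutationModel

/-! ### Isometries of Baire space and the groups `G_{n,F}`. -/

namespace Baire

/-- The distance depends only on which initial segments agree. -/
theorem isIsom_of_agree {φ : (ℕ → ℕ) → (ℕ → ℕ)}
    (h : ∀ n f g, (∀ i < n, φ f i = φ g i) ↔ ∀ i < n, f i = g i) : IsIsom φ := by
  have key : ∀ f g f' g' : ℕ → ℕ,
      (∀ n, (∀ i < n, f i = g i) → ∀ i < n, f' i = g' i) → d f' g' ≤ d f g := by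
    intro f g f' g' hn
    by_cases hfg : f = g
    · have : f' = g' := funext fun k => hn (k + 1) (fun i _ => by rw [hfg]) k k.lt_succ_self
      simp [d, hfg, this]
    · have hd : d f g = 1 / (1 + (sInf {k : ℕ | f k ≠ g k} : ℕ)) := if_neg hfg
      rw [hd, ← agree_iff]
      exact hn _ ((agree_iff _ f g).2 hd.le)
  exact fun f g => le_antisymm (key _ _ _ _ fun n => (h n f g).2) (key _ _ _ _ fun n => (h n f g).1)

open Classical in
/-- The map that interchanges the balls of radius `m + 1` around `u` and `v` coordinatewise and
fixes all other points. -/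
noncomputable def swapBall (m : ℕ) (u v f : ℕ → ℕ) : ℕ → ℕ :=
  if (∀ i < m, f i = u i) ∧ (f m = u m ∨ f m = v m) then fun i => Equiv.swap (u i) (v i) (f i)
  else f

section swapBall

variable {m : ℕ} {u v : ℕ → ℕ}

theorem swapBall_self : swapBall m u v u = v := by
  funext i
  simp [swapBall]

theorem swapBall_apply_of_lt (huv : ∀ i < m, u i = v i) (f : ℕ → ℕ) {i : ℕ} (hi : i < m) :
    swapBall m u v f i = f i := by
  unfold swapBall
  split_ifs with h
  · simp [huv i hi]
  · rfl

/-- The transpositions are trivial below `m` and preserve `{u m, v m}` at place `m`, so the region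
where `swapBall` acts is invariant. -/
theorem swapBall_swapBall (huv : ∀ i < m, u i = v i) (f : ℕ → ℕ) :
    swapBall m u v (swapBall m u v f) = f := by
  by_cases h : (∀ i < m, f i = u i) ∧ (f m = u m ∨ f m = v m)
  · have h1 : swapBall m u v f = fun i => Equiv.swap (u i) (v i) (f i) := if_pos h
    have h2 : (∀ i < m, swapBall m u v f i = u i) ∧
        (swapBall m u v f m = u m ∨ swapBall m u v f m = v m) := by
      refine ⟨fun i hi => by rw [swapBall_apply_of_lt huv f hi, h.1 i hi], ?_⟩
      rw [h1]
      rcases h.2 with h3 | h3 <;> simp [h3]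
    have h4 : swapBall m u v (swapBall m u v f) =
        fun i => Equiv.swap (u i) (v i) (swapBall m u v f i) := if_pos h2
    rw [h4, h1]
    funext i
    simp
  · have h1 : swapBall m u v f = f := if_neg h
    rw [h1, h1]

/-- Nothing changes below `m`; points that agree through place `m` lie both inside or both outside
the swapped region. -/
theorem swapBall_agree (huv : ∀ i < m, u i = v i) {n : ℕ} {f g : ℕ → ℕ}
    (h : ∀ i < n, f i = g i) : ∀ i < n, swapBall m u v f i = swapBall m u v g i := by
  intro i hi
  by_cases him : i < m
  · rw [swapBall_apply_of_lt huv f him, swapBall_apply_of_lt huv g him, h i hi]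
  · have hc : ((∀ i < m, f i = u i) ∧ (f m = u m ∨ f m = v m)) ↔
        ((∀ i < m, g i = u i) ∧ (g m = u m ∨ g m = v m)) := by
      rw [h m (by omega)]
      refine and_congr_left fun _ => forall₂_congr fun j hj => ?_
      rw [h j (by omega)]
    unfold swapBall
    split_ifs with h1 h2 h2
    · simp [h i hi]
    · exact (h2 (hc.1 h1)).elim
    · exact (h1 (hc.2 h2)).elim
    · exact h i hi

theorem isIsom_swapBall (huv : ∀ i < m, u i = v i) : IsIsom (swapBall m u v) :=
  isIsom_of_agree fun n f g =>
    ⟨fun h => by simpa only [swapBall_swapBall huv] using swapBall_agree huv h, swapBall_agree huv⟩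

end swapBall

variable {A : Type u} {a : (ℕ → ℕ) ≃ A}

theorem basicGroup_le_group (n : ℕ) (F : Finset (ℕ → ℕ)) : basicGroup a n F ≤ group a :=
  fun _ ⟨φ, hφ, h, _⟩ => ⟨φ, hφ, h⟩

theorem basicGroup_anti {n m : ℕ} {E F : Finset (ℕ → ℕ)} (hnm : n ≤ m) (hEF : F ⊆ E) :
    basicGroup a m E ≤ basicGroup a n F := by
  intro π hπ
  rw [mem_basicGroup_iff] at hπ ⊢
  obtain ⟨φ, hφ, h, h1, h2⟩ := hπ
  exact ⟨φ, hφ, h, fun f hf => h1 f (hEF hf), fun f i hi => h2 f i (hi.trans_le hnm)⟩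

theorem basicGroup_mem (n : ℕ) (F : Finset (ℕ → ℕ)) :
    basicGroup a n F ∈ (normalFilter a).sets :=
  ⟨basicGroup_le_group n F, n, F, le_rfl⟩

/-- The isometry of `ω^ω` that induces `π` if `π ∈ group a`. -/
def coord (a : (ℕ → ℕ) ≃ A) (π : Equiv.Perm A) (f : ℕ → ℕ) : ℕ → ℕ := a.symm (π (a f))

theorem induces_coord (π : Equiv.Perm A) : Induces a (coord a π) π := fun f => by simp [coord]

theorem Induces.eq_coord {φ : (ℕ → ℕ) → (ℕ → ℕ)} {π : Equiv.Perm A} (h : Induces a φ π) :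
    φ = coord a π := funext fun f => by simp [coord, h f]

theorem coord_mul (π ρ : Equiv.Perm A) (f : ℕ → ℕ) :
    coord a (π * ρ) f = coord a π (coord a ρ f) := by
  simp [coord]

theorem coord_inv_coord (π : Equiv.Perm A) (f : ℕ → ℕ) :
    coord a π⁻¹ (coord a π f) = f := by
  simp [coord]

theorem coord_coord_inv (π : Equiv.Perm A) (f : ℕ → ℕ) :
    coord a π (coord a π⁻¹ f) = f := by
  simp [coord]

theorem mem_group_iff_coord {π : Equiv.Perm A} : π ∈ group a ↔ IsIsom (coord a π) := by
  constructor
  · rintro ⟨φ, hφ, h⟩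
    rwa [← h.eq_coord]
  · exact fun h => ⟨_, h, induces_coord π⟩

theorem mem_basicGroup_iff_coord {n : ℕ} {F : Finset (ℕ → ℕ)} {π : Equiv.Perm A} :
    π ∈ basicGroup a n F ↔ IsIsom (coord a π) ∧ (∀ f ∈ F, coord a π f = f) ∧
      ∀ f, ∀ i < n, coord a π f i = f i := by
  rw [mem_basicGroup_iff]
  constructor
  · rintro ⟨φ, hφ, h, h'⟩
    rw [h.eq_coord] at hφ h'
    exact ⟨hφ, h'⟩
  · exact fun h => ⟨_, h.1, induces_coord π, h.2⟩

/-- `G_{m,F}` is normal in `G_{n,F}`. -/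
theorem conj_mem_basicGroup {n m : ℕ} {F : Finset (ℕ → ℕ)} {π ρ : Equiv.Perm A}
    (hπ : π ∈ basicGroup a n F) (hρ : ρ ∈ basicGroup a m F) :
    π⁻¹ * ρ * π ∈ basicGroup a m F := by
  have hi := mem_group_iff_coord.1 ((group a).mul_mem ((group a).mul_mem
    ((group a).inv_mem (basicGroup_le_group _ _ hπ)) (basicGroup_le_group _ _ hρ))
    (basicGroup_le_group _ _ hπ))
  rw [mem_basicGroup_iff_coord] at hπ hρ ⊢
  refine ⟨hi, fun f hf => ?_, fun f => ?_⟩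
  · rw [coord_mul, coord_mul, hπ.2.1 f hf, hρ.2.1 f hf]
    conv_lhs => rw [← hπ.2.1 f hf, coord_inv_coord]
  -- Agreement below `m` may be tested after applying the isometry of `π`, which cancels `π⁻¹`.
  · rw [← hπ.1.agree, coord_mul, coord_mul, coord_coord_inv]
    exact hρ.2.2 _

/-- Two points that agree below `m` are interchanged by an element of `G_{m,F}` if no point of `F`
agrees with one of them up to `m`. -/
theorem exists_mem_basicGroup {m : ℕ} {F : Finset (ℕ → ℕ)} {u v : ℕ → ℕ}
    (huv : ∀ i < m, u i = v i) (hu : ∀ f ∈ F, ∃ i ≤ m, f i ≠ u i)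
    (hv : ∀ f ∈ F, ∃ i ≤ m, f i ≠ v i) :
    ∃ π ∈ basicGroup a m F, coord a π u = v := by
  have hinv := swapBall_swapBall huv
  let π : Equiv.Perm A := a.symm.trans ((Function.Involutive.toPerm _ hinv).trans a)
  have hπ : coord a π = swapBall m u v := by
    funext f
    simp only [coord, π, Equiv.trans_apply, Equiv.symm_apply_apply]
    rfl
  refine ⟨π, mem_basicGroup_iff_coord.2 ⟨?_, ?_, ?_⟩, ?_⟩
  · rw [hπ]
    exact isIsom_swapBall huv
  · intro f hf
    rw [hπ]
    refine if_neg ?_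
    rintro ⟨h1, h2⟩
    obtain ⟨i, hi, hiu⟩ := hu f hf
    obtain ⟨j, hj, hjv⟩ := hv f hf
    rcases hi.lt_or_eq with hi | rfl
    · exact hiu (h1 i hi)
    rcases hj.lt_or_eq with hj | rfl
    · exact hjv ((h1 j hj).trans (huv j hj))
    exact h2.elim hiu hjv
  · intro f i hi
    rw [hπ]
    exact swapBall_apply_of_lt huv f hi
  · rw [hπ]
    exact swapBall_self

/-- Finitely many points are told apart from `e` by their values below some `m`. -/
theorem exists_separating (F : Finset (ℕ → ℕ)) (e : ℕ → ℕ) :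
    ∃ m, ∀ f ∈ F, f ≠ e → ∃ i < m, f i ≠ e i := by
  classical
  induction F using Finset.induction_on with
  | empty => exact ⟨0, by simp⟩
  | insert f F _ ih =>
    obtain ⟨m, hm⟩ := ih
    by_cases hfe : f = e
    · refine ⟨m, fun g hg hge => ?_⟩
      rcases Finset.mem_insert.1 hg with rfl | hg
      · exact (hge hfe).elim
      · exact hm g hg hge
    · obtain ⟨k, hk⟩ := Function.ne_iff.1 hfe
      refine ⟨max m (k + 1), fun g hg hge => ?_⟩
      rcases Finset.mem_insert.1 hg with rfl | hg
      · exact ⟨k, by simp, hk⟩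
      · obtain ⟨i, hi, h⟩ := hm g hg hge
        exact ⟨i, hi.trans_le (le_max_left _ _), h⟩

/-- One level that works for all pairs allows support points to be removed one after another without
changing it. -/
theorem exists_separating_pairs (F : Finset (ℕ → ℕ)) :
    ∃ m, ∀ e ∈ F, ∀ f ∈ F, f ≠ e → ∃ i < m, f i ≠ e i := by
  choose m hm using exists_separating F
  refine ⟨F.sup m, fun e he f hf hfe => ?_⟩
  obtain ⟨i, hi, h⟩ := hm e f hf hfe
  exact ⟨i, hi.trans_le (Finset.le_sup he), h⟩

/-! ### Reducing supports when there are few orbits. -/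

section orbits

variable {M : Type*}

/-- The group `H` has only finitely many orbits on `X`. -/
def FewOrbits (a : (ℕ → ℕ) ≃ A) [MulAction (group a) M] (H : Subgroup (Equiv.Perm A)) (X : Set M) : Prop :=
  ∃ T : Set M, T.Finite ∧ T ⊆ X ∧
    ∀ x ∈ X, ∃ t ∈ T, ∃ π : group a, (π : Equiv.Perm A) ∈ H ∧ π • t = x

variable [MulAction (group a) M]

/-- A point `e` of a support of `x` that is told apart from the other points of the support below
`m` can be omitted, if `G_{m+1}` has only finitely many orbits. -/
theorem fixed_of_fewOrbits [DecidableEq (ℕ → ℕ)] {m : ℕ} {E : Finset (ℕ → ℕ)} {e : ℕ → ℕ}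
    (he : ∀ f ∈ E, ∃ i < m, f i ≠ e i) {x : M} {X : Set M}
    (hx : ∀ π : group a, (π : Equiv.Perm A) ∈ basicGroup a m (insert e E) → π • x = x)
    (hX : ∀ π : group a, (π : Equiv.Perm A) ∈ basicGroup a m E → π • x ∈ X)
    (hfew : FewOrbits a (basicGroup a (m + 1) E) X) :
    ∀ π : group a, (π : Equiv.Perm A) ∈ basicGroup a m E → π • x = x := by
  have hk : ∀ j : ℕ, ∃ k : group a, (k : Equiv.Perm A) ∈ basicGroup a m E ∧
      coord a k e m = j := by
    intro j
    have hv : ∀ i < m, e i = Function.update e m j i := fun i hi => by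
      rw [Function.update_of_ne hi.ne]
    obtain ⟨k, hk, hke⟩ := exists_mem_basicGroup (a := a) (F := E) hv
      (fun f hf => (he f hf).imp fun i hi => ⟨hi.1.le, hi.2⟩)
      (fun f hf => (he f hf).imp fun i hi => ⟨hi.1.le, by rw [← hv i hi.1]; exact hi.2⟩)
    exact ⟨⟨k, basicGroup_le_group _ _ hk⟩, hk, by simp [hke]⟩
  choose k hk hke using hk
  obtain ⟨T, hT, -, hTX⟩ := hfew
  have hrep := fun j => hTX _ (hX (k j) (hk j))
  choose t htT p hp hpt using hrep
  -- Among the infinitely many translates `k j • x`, two lie in the same orbit of `G_{m+1,E}`.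
  obtain ⟨i, -, j, -, hij, htij⟩ :=
    Set.infinite_univ.exists_ne_map_eq_of_mapsTo (f := t) (fun j _ => htT j) hT
  set h : group a := (k j)⁻¹ * (p j * (p i)⁻¹) * k i with hh
  have hhx : h • x = x := by
    rw [hh, mul_smul, mul_smul, mul_smul, ← hpt i, inv_smul_smul, htij, hpt j, inv_smul_smul]
  have hpm : ∀ j, (p j : Equiv.Perm A) ∈ basicGroup a m E := fun j =>
    basicGroup_anti m.le_succ subset_rfl (hp j)
  have hhE : (h : Equiv.Perm A) ∈ basicGroup a m E :=
    mul_mem (mul_mem (inv_mem (hk j)) (mul_mem (hpm j) (inv_mem (hpm i)))) (hk i)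
  -- Otherwise `k j` would give `h e` and `e` the same value at `m`. These values are `i` and `j`,
  -- because `p j * (p i)⁻¹` preserves place `m`.
  have hhe : coord a h e m ≠ e m := by
    intro hc
    have h1 : ∀ l < m + 1, coord a h e l = e l := by
      intro l hl
      rcases Nat.lt_succ_iff_lt_or_eq.1 hl with hl | rfl
      · exact (mem_basicGroup_iff_coord.1 hhE).2.2 e l hl
      · exact hc
    have h2 := (mem_basicGroup_iff_coord.1 (hk j)).1.agree.2 h1 m m.lt_succ_self
    have h3 : coord a (k j) (coord a h e) =
        coord a ((p j * (p i)⁻¹ : group a) : Equiv.Perm A) (coord a (k i) e) := by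
      rw [← coord_mul, ← coord_mul, ← Subgroup.coe_mul, ← Subgroup.coe_mul, hh]
      congr 2
      group
    have h4 : ((p j * (p i)⁻¹ : group a) : Equiv.Perm A) ∈ basicGroup a (m + 1) E :=
      mul_mem (hp j) (inv_mem (hp i))
    rw [h3, (mem_basicGroup_iff_coord.1 h4).2.2 _ m m.lt_succ_self, hke, hke] at h2
    exact hij h2
  have main : ∀ g : group a, (g : Equiv.Perm A) ∈ basicGroup a m E → coord a g e m ≠ e m →
      g • x = x := by
    intro g hg hge
    have hg' := (mem_basicGroup_iff_coord.1 hg).2.2 e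
    have hh' := (mem_basicGroup_iff_coord.1 hhE).2.2 e
    -- Both `h e` and `g e` leave `e` exactly at place `m`, so they can be interchanged with `e`
    -- fixed. Then `g⁻¹ * q * h` fixes `e`, hence `x`; so do `q` and `h`, and therefore `g`.
    obtain ⟨q, hq, hqe⟩ := exists_mem_basicGroup (a := a) (m := m) (F := insert e E)
      (u := coord a h e) (v := coord a g e) (fun i hi => by rw [hg' i hi, hh' i hi])
      (by
        intro f hf
        rcases Finset.mem_insert.1 hf with rfl | hf
        · exact ⟨m, le_rfl, hhe.symm⟩
        · obtain ⟨i, hi, hfe⟩ := he f hf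
          exact ⟨i, hi.le, by rwa [hh' i hi]⟩)
      (by
        intro f hf
        rcases Finset.mem_insert.1 hf with rfl | hf
        · exact ⟨m, le_rfl, hge.symm⟩
        · obtain ⟨i, hi, hfe⟩ := he f hf
          exact ⟨i, hi.le, by rwa [hg' i hi]⟩)
    let q' : group a := ⟨q, basicGroup_le_group _ _ hq⟩
    have hr : ((g⁻¹ * q' * h : group a) : Equiv.Perm A) ∈ basicGroup a m (insert e E) := by
      have h0 : ((g⁻¹ * q' * h : group a) : Equiv.Perm A) ∈ basicGroup a m E :=
        mul_mem (mul_mem (inv_mem hg) (basicGroup_anti le_rfl (Finset.subset_insert _ _) hq)) hhE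
      rw [mem_basicGroup_iff_coord] at h0 ⊢
      refine ⟨h0.1, fun f hf => ?_, h0.2.2⟩
      rcases Finset.mem_insert.1 hf with rfl | hf
      · rw [Subgroup.coe_mul, Subgroup.coe_mul, Subgroup.coe_inv, coord_mul, coord_mul, hqe,
          coord_inv_coord]
      · exact h0.2.1 f hf
    have h1 := hx _ hr
    have h2 : q' • x = x := hx q' hq
    rw [mul_smul, mul_smul, hhx, h2, inv_smul_eq_iff] at h1
    exact h1.symm
  intro g hg
  -- If `g` does not move `e` at place `m`, then `h * g` does, and `h` can be cancelled.
  by_cases hge : coord a g e m = e m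
  · have hgE := mem_basicGroup_iff_coord.1 hg
    have h1 : (h * g) • x = x := by
      refine main _ (mul_mem hhE hg) ?_
      have h2 : ∀ l < m + 1, coord a g e l = e l := by
        intro l hl
        rcases Nat.lt_succ_iff_lt_or_eq.1 hl with hl | rfl
        · exact hgE.2.2 e l hl
        · exact hge
      rw [Subgroup.coe_mul, coord_mul,
        (mem_basicGroup_iff_coord.1 hhE).1.agree.2 h2 m m.lt_succ_self]
      exact hhe
    rw [mul_smul] at h1
    have h3 : h • g • x = h • x := h1.trans hhx.symm
    exact smul_left_cancel h h3
  · exact main g hg hge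

/-- If all points of the invariant set `X` have a support, but no `G_{m,E}` has infinitely many
orbits on `X`, then `X` is finite. -/
theorem finite_of_fewOrbits {n : ℕ} {F : Finset (ℕ → ℕ)} {X : Set M}
    (hX : ∀ π : group a, (π : Equiv.Perm A) ∈ basicGroup a n F → ∀ x ∈ X, π • x ∈ X)
    (hsupp : ∀ x ∈ X, ∃ m E, ∀ π : group a, (π : Equiv.Perm A) ∈ basicGroup a m E → π • x = x)
    (hfew : ∀ m E, n ≤ m → F ⊆ E → FewOrbits a (basicGroup a m E) X) : X.Finite := by
  classical
  have hfix : ∀ x ∈ X, ∃ m, n ≤ m ∧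
      ∀ π : group a, (π : Equiv.Perm A) ∈ basicGroup a m F → π • x = x := by
    intro x hx
    obtain ⟨m, E, hE⟩ := hsupp x hx
    obtain ⟨l, hl⟩ := exists_separating_pairs (F ∪ E)
    set N := max n (max m l)
    refine ⟨N, le_max_left _ _, ?_⟩
    have hmN : m ≤ N := (le_max_left _ _).trans (le_max_right _ _)
    have hlN : l ≤ N := (le_max_right _ _).trans (le_max_right _ _)
    -- The points of `E` outside `F` are discarded one by one at the fixed level `N`.
    have ind : ∀ D : Finset (ℕ → ℕ), D ⊆ E →
        (∀ π : group a, (π : Equiv.Perm A) ∈ basicGroup a N (F ∪ D) → π • x = x) →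
        ∀ π : group a, (π : Equiv.Perm A) ∈ basicGroup a N F → π • x = x := by
      intro D
      induction D using Finset.induction_on with
      | empty => simp
      | insert e D _ ih =>
        intro hDE h
        have hDE' : D ⊆ E := (Finset.subset_insert _ _).trans hDE
        refine ih hDE' ?_
        by_cases heF : e ∈ F
        · rwa [Finset.union_insert, Finset.insert_eq_self.2 (Finset.mem_union_left _ heF)] at h
        by_cases heD : e ∈ D
        · rwa [Finset.insert_eq_self.2 heD] at h
        rw [Finset.union_insert] at h
        refine fixed_of_fewOrbits (X := X) (e := e) ?_ h ?_
          (hfew _ _ ((le_max_left _ _).trans N.le_succ) Finset.subset_union_left)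
        · intro f hf
          have hne : f ≠ e := by
            rintro rfl
            exact (Finset.mem_union.1 hf).elim heF heD
          obtain ⟨i, hi, hfe⟩ := hl e (Finset.mem_union_right _ (hDE (Finset.mem_insert_self _ _)))
            f (Finset.union_subset_union_right hDE' hf) hne
          exact ⟨i, hi.trans_le hlN, hfe⟩
        · exact fun π hπ => hX π
            (basicGroup_anti (le_max_left _ _) Finset.subset_union_left hπ) x hx
    exact ind E subset_rfl fun π hπ => hE π (basicGroup_anti hmN Finset.subset_union_right hπ)
  choose! μ hμ hμ' using hfix
  obtain ⟨T, hT, hTX, hrep⟩ := hfew n F le_rfl subset_rfl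
  set m := max n (hT.toFinset.sup μ)
  have hall : ∀ x ∈ X, ∀ π : group a, (π : Equiv.Perm A) ∈ basicGroup a m F → π • x = x := by
    intro x hx π hπ
    obtain ⟨t, ht, ρ, hρ, rfl⟩ := hrep x hx
    -- By normality the bound found for the finitely many representatives holds on their whole
    -- orbits.
    have h1 : (ρ⁻¹ * π * ρ) • t = t := by
      refine hμ' t (hTX ht) _ (basicGroup_anti ?_ subset_rfl (conj_mem_basicGroup hρ hπ))
      exact (Finset.le_sup (f := μ) (hT.mem_toFinset.2 ht)).trans (le_max_right _ _)
    rwa [mul_smul, mul_smul, inv_smul_eq_iff] at h1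
  obtain ⟨S, hS, hSX, hrep'⟩ := hfew m F (le_max_left _ _) subset_rfl
  refine hS.subset fun x hx => ?_
  obtain ⟨t, ht, π, hπ, rfl⟩ := hrep' x hx
  rwa [hall t (hSX ht) π hπ]

/-- An infinite invariant set all of whose points have a support is mapped onto `ω` by a function
that is invariant under some `G_{m,E}`. -/
theorem exists_invariant_surjection {n : ℕ} {F : Finset (ℕ → ℕ)} {X : Set M}
    (hX : ∀ π : group a, (π : Equiv.Perm A) ∈ basicGroup a n F → ∀ x ∈ X, π • x ∈ X)
    (hsupp : ∀ x ∈ X, ∃ m E, ∀ π : group a, (π : Equiv.Perm A) ∈ basicGroup a m E → π • x = x)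
    (hinf : X.Infinite) :
    ∃ m E, ∃ θ : M → ℕ, n ≤ m ∧ F ⊆ E ∧
      (∀ π : group a, (π : Equiv.Perm A) ∈ basicGroup a m E → ∀ x, θ (π • x) = θ x) ∧
      ∀ k, ∃ x ∈ X, θ x = k := by
  have : ∃ m E, n ≤ m ∧ F ⊆ E ∧ ¬ FewOrbits a (basicGroup a m E) X := by
    by_contra! h
    exact hinf (finite_of_fewOrbits hX hsupp h)
  obtain ⟨m, E, hm, hE, hfew⟩ := this
  let H : Subgroup (group a) := (basicGroup a m E).subgroupOf (group a)
  let q : M → MulAction.orbitRel.Quotient H M := Quotient.mk _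
  have hq : (q '' X).Infinite := by
    intro hfin
    obtain ⟨T, hTX, hT⟩ := Set.exists_subset_bijOn X q
    refine hfew ⟨T, Set.Finite.of_finite_image (hT.image_eq ▸ hfin) hT.injOn, hTX, fun x hx => ?_⟩
    obtain ⟨t, ht, htx⟩ := hT.surjOn ⟨x, hx, rfl⟩
    obtain ⟨⟨π, hπ⟩, h⟩ := Quotient.exact htx.symm
    exact ⟨t, ht, π, hπ, h⟩
  let ε := hq.natEmbedding
  have hε : Function.Injective fun k => (ε k : MulAction.orbitRel.Quotient H M) :=
    Subtype.val_injective.comp ε.injective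
  -- The `k`-th chosen orbit gets the value `k`; all orbits not chosen get one arbitrary value.
  refine ⟨m, E, fun x => Function.invFun (fun k => (ε k : MulAction.orbitRel.Quotient H M)) (q x),
    hm, hE, fun π hπ x => ?_, fun k => ?_⟩
  · exact congrArg _ (Quotient.sound ⟨⟨π, hπ⟩, rfl⟩)
  · obtain ⟨x, hx, h⟩ := (ε k).2
    refine ⟨x, hx, ?_⟩
    simp only [h]
    exact Function.leftInverse_invFun hε k

end orbits

end Baire

/-! ### C-infinite sets and Form 82 in the model. -/

namespace Baire

open PermutationModel Internal

variable {A : Type u} {a : (ℕ → ℕ) ≃ A}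

theorem exists_basicGroup_fixing (x : PermutationModel (normalFilter a)) :
    ∃ m E, ∀ π : group a, (π : Equiv.Perm A) ∈ basicGroup a m E → π • x = x := by
  obtain ⟨H, ⟨-, m, E, hE⟩, h⟩ := exists_stabilizer x
  exact ⟨m, E, fun π hπ => h π (hE hπ)⟩

/-- Every infinite set of the model is mapped onto `ω` by a symmetric function. -/
theorem exists_symmetric_surjection {X : PermutationModel (normalFilter a)} (hX : IsInfinite X) :
    ∃ H ∈ (normalFilter a).sets, ∃ θ : PermutationModel (normalFilter a) → ℕ,
      (∀ π : group a, (π : Equiv.Perm A) ∈ H → ∀ x ∈ X, π • x ∈ X) ∧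
      (∀ π : group a, (π : Equiv.Perm A) ∈ H → ∀ x, θ (π • x) = θ x) ∧
      ∀ k, ∃ x ∈ X, θ x = k := by
  obtain ⟨n, F, hF⟩ := exists_basicGroup_fixing X
  obtain ⟨m, E, θ, hm, hE, hθ, hsurj⟩ := exists_invariant_surjection (a := a)
    (X := {x | x ∈ X}) (fun π hπ x hx => smul_mem_of_smul_eq (hF π hπ) hx)
    (fun x _ => exists_basicGroup_fixing x) (isInfinite_iff.1 hX).2
  exact ⟨_, basicGroup_mem m E, θ,
    fun π hπ x hx => smul_mem_of_smul_eq (hF π (basicGroup_anti hm hE hπ)) hx, hθ, hsurj⟩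

theorem isCInfinite_of_isInfinite {X : PermutationModel (normalFilter a)} (hX : IsInfinite X) :
    IsCInfinite X := by
  obtain ⟨H, hH, θ, hHX, hθ, hsurj⟩ := exists_symmetric_surjection hX
  obtain ⟨f, hf, hfm⟩ := exists_function (X := X) (Y := omega) (fun x => nat (θ x))
    (fun x _ => mem_omega.2 ⟨_, rfl⟩) hH hHX fun π hπ x _ => by rw [hθ π hπ x, smul_nat]
  refine ⟨omega, f, isOmega_omega, hf, fun y hy => ?_⟩
  obtain ⟨k, rfl⟩ := mem_omega.1 hy
  obtain ⟨x, hx, rfl⟩ := hsurj k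
  exact ⟨x, (hfm _ _).2 ⟨hx, rfl⟩⟩

/-- The map from `k` to the fibre of `θ` over `k` is injective because the fibres are nonempty and
disjoint; it is symmetric because each fibre is fixed by `H`. -/
theorem form82 : Form82 (PermutationModel (normalFilter a)) := by
  intro X hX
  obtain ⟨P, hP⟩ := exists_powerSet X
  obtain ⟨H, hH, θ, hHX, hθ, hsurj⟩ := exists_symmetric_surjection hX
  have hfib : ∀ k, ∃ s : PermutationModel (normalFilter a), IsSet s ∧
      ∀ x, x ∈ s ↔ x ∈ X ∧ θ x = k := by
    intro k
    have : Small.{u} {x | x ∈ X} := small_mem X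
    have : Small.{u} {x | x ∈ X ∧ θ x = k} :=
      small_subset.{u} (s := {x | x ∈ X}) (t := {x | x ∈ X ∧ θ x = k}) fun x hx => hx.1
    exact exists_set {x | x ∈ X ∧ θ x = k} hH fun π hπ x hx =>
      ⟨hHX π hπ x hx.1, (hθ π hπ x).trans hx.2⟩
  choose s hs hsm using hfib
  have hsmul : ∀ π : group a, (π : Equiv.Perm A) ∈ H → ∀ k, π • s k = s k := by
    intro π hπ k
    refine ext ((isSet_smul_iff π).2 (hs k)) (hs k) fun x => ?_
    rw [mem_smul_iff, hsm, hsm, hθ π⁻¹ (H.inv_mem hπ)]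
    refine and_congr_left fun _ => ⟨fun h => ?_, hHX π⁻¹ (H.inv_mem hπ) x⟩
    simpa using hHX π hπ _ h
  have hinv := Function.leftInverse_invFun (nat_injective (F := normalFilter a))
  obtain ⟨f, hf, hfm⟩ := exists_function (X := omega) (Y := P)
    (fun z => s (Function.invFun nat z))
    (fun z _ => (hP.2 _).2 ⟨hs _, fun x hx => ((hsm _ x).1 hx).1⟩) hH
    (fun π _ z hz => by
      obtain ⟨k, rfl⟩ := mem_omega.1 hz
      rwa [smul_nat])
    (fun π hπ z hz => by
      obtain ⟨k, rfl⟩ := mem_omega.1 hz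
      rw [smul_nat, hsmul π hπ])
  refine ⟨P, hP, omega, f, isOmega_omega, hf, fun z z' y hz hz' => ?_⟩
  rw [hfm] at hz hz'
  obtain ⟨k, rfl⟩ := mem_omega.1 hz.1
  obtain ⟨j, rfl⟩ := mem_omega.1 hz'.1
  have h := hz.2.symm.trans hz'.2
  simp only [hinv _] at h
  obtain ⟨x, hx, hxk⟩ := hsurj k
  have h1 := (hsm j x).1 (h ▸ (hsm k x).2 ⟨hx, hxk⟩)
  rw [← hxk, h1.2]

/-! ### The set of atoms -/

/-- `p` consists of two atoms whose indices differ for the first time at an even place. -/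
def IsEvenPair (p : PermutationModel (normalFilter a)) : Prop :=
  ∃ (u v : ℕ → ℕ) (k : ℕ), Even k ∧ (∀ i < k, u i = v i) ∧ u k ≠ v k ∧
    p = pair (atom _ (a u)) (atom _ (a v))

/-- Isometries preserve the first place of difference, so the parity colouring is invariant under
the whole group and lies in the model. -/
theorem IsEvenPair.smul {p : PermutationModel (normalFilter a)} (hp : IsEvenPair p)
    (π : group a) : IsEvenPair (π • p) := by
  obtain ⟨u, v, k, hk, huv, huvk, rfl⟩ := hp
  have hπ : IsIsom (coord a π) := mem_group_iff_coord.1 π.2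
  have hag := hπ.agree.2 huv
  refine ⟨coord a π u, coord a π v, k, hk, hag, fun h => ?_, ?_⟩
  · refine huvk ((hπ.agree (n := k + 1)).1 (fun i hi => ?_) k k.lt_succ_self)
    rcases Nat.lt_succ_iff_lt_or_eq.1 hi with hi | rfl
    · exact hag i hi
    · exact h
  · rw [smul_pair, smul_atom, smul_atom, induces_coord, induces_coord]

theorem isEvenPair_smul_iff {p : PermutationModel (normalFilter a)} (π : group a) :
    IsEvenPair (π • p) ↔ IsEvenPair p :=
  ⟨fun h => by simpa using h.smul π⁻¹, fun h => h.smul π⟩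

theorem isEvenPair_pair_iff {u v : ℕ → ℕ} {k : ℕ} (huv : ∀ i < k, u i = v i) (hk : u k ≠ v k) :
    IsEvenPair (pair (atom _ (a u)) (atom _ (a v)) : PermutationModel (normalFilter a)) ↔
      Even k := by
  constructor
  · rintro ⟨u', v', j, hj, huv', hj', h⟩
    have key : ∀ {u' v' : ℕ → ℕ}, u = u' → v = v' → (∀ i < j, u' i = v' i) → u' j ≠ v' j →
        Even k := by
      rintro _ _ rfl rfl h1 h2
      rcases lt_trichotomy k j with h | rfl | h
      · exact (hk (h1 k h)).elim
      · exact hj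
      · exact (h2 (huv j h)).elim
    have inj : ∀ {f g : ℕ → ℕ}, atom (normalFilter a) (a f) = atom _ (a g) → f = g :=
      fun h => a.injective (atom_injective h)
    rcases pair_inj h with ⟨h1, h2⟩ | ⟨h1, h2⟩
    · exact key (inj h1) (inj h2) huv' hj'
    · exact key (inj h1) (inj h2) (fun i hi => (huv' i hi).symm) hj'.symm
  · exact fun h => ⟨u, v, k, h, huv, hk, rfl⟩

theorem mem_atomSet_iff {S x : PermutationModel (normalFilter a)} (hS : IsAtomSet S) :
    x ∈ S ↔ ∃ f, x = atom _ (a f) := by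
  rw [hS.2, isAtom_iff]
  exact ⟨fun ⟨b, hb⟩ => ⟨a.symm b, by rw [hb, a.apply_symm_apply]⟩, fun ⟨f, hf⟩ => ⟨_, hf⟩⟩

theorem isInfinite_atomSet {S : PermutationModel (normalFilter a)} (hS : IsAtomSet S) :
    IsInfinite S := by
  refine isInfinite_iff.2 ⟨hS.1, ?_⟩
  refine (Set.infinite_range_of_injective (atom_injective.comp a.injective)).mono ?_
  rintro _ ⟨f, rfl⟩
  exact (mem_atomSet_iff hS).2 ⟨f, rfl⟩

/-- An infinite disjoint family of finite sets of atoms contains all singletons of atoms in some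
ball. -/
theorem exists_ball_of_disjoint {S Y : PermutationModel (normalFilter a)} (hS : IsAtomSet S)
    (hYS : ∀ y ∈ Y, IsSubset y S ∧ IsFinite y) (hY : IsInfinite Y) (hdisj : IsPairwiseDisjoint Y) :
    ∃ (e : ℕ → ℕ) (l : ℕ), ∀ v : ℕ → ℕ, (∀ i < l, e i = v i) →
      pair (atom _ (a v)) (atom _ (a v)) ∈ Y := by
  classical
  obtain ⟨n, E, hE⟩ := exists_basicGroup_fixing Y
  have hex : ∃ y ∈ Y, ∃ e, e ∉ E ∧ atom _ (a e) ∈ y := by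
    by_contra! hc
    -- If every member used only atoms indexed by `E`, then `Y` would embed into the power set of a
    -- finite set.
    refine (isInfinite_iff.1 hY).2 (Set.Finite.of_finite_image (f := fun y => {z | z ∈ y})
      ((E.finite_toSet.image fun f => atom _ (a f)).finite_subsets.subset ?_) ?_)
    · rintro _ ⟨y, hy, rfl⟩ z hz
      obtain ⟨f, rfl⟩ := (mem_atomSet_iff hS).1 ((hYS y hy).1.2 z hz)
      exact ⟨f, by_contra fun hf => hc y hy f hf hz, rfl⟩
    · exact fun y hy y' hy' h => ext (hYS y hy).1.1 (hYS y' hy').1.1 (Set.ext_iff.1 h)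
  obtain ⟨y, hy, e, heE, hey⟩ := hex
  have hD : {f | atom (normalFilter a) (a f) ∈ y}.Finite :=
    Set.Finite.preimage (f := atom (normalFilter a) ∘ a) (s := {z | z ∈ y}) (atom_injective.comp a.injective).injOn
      (isFinite_iff.1 (hYS y hy).2).2
  obtain ⟨l, hl⟩ := exists_separating (E ∪ hD.toFinset) e
  -- The points to be held fixed while `e` moves: the support of `Y` and the remaining atoms of `y`.
  set D := (E ∪ hD.toFinset).erase e with hDdef
  have hmove : ∀ v : ℕ → ℕ, (∀ i < max n l, e i = v i) → v ≠ e →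
      y = pair (atom _ (a e)) (atom _ (a e)) ∧ pair (atom _ (a v)) (atom _ (a v)) ∈ Y := by
    intro v hv hve
    have hne : ∃ m, e m ≠ v m := Function.ne_iff.1 hve.symm
    obtain ⟨m, hm, hmin⟩ : ∃ m, e m ≠ v m ∧ ∀ i < m, e i = v i :=
      ⟨Nat.find hne, Nat.find_spec hne, fun i hi => not_not.1 (Nat.find_min hne hi)⟩
    have hnm : max n l ≤ m := not_lt.1 fun h => hm (hv m h)
    have hsep : ∀ f ∈ D, ∃ i < max n l, f i ≠ e i := by
      intro f hf
      rw [hDdef, Finset.mem_erase] at hf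
      obtain ⟨i, hi, h⟩ := hl f hf.2 hf.1
      exact ⟨i, hi.trans_le (le_max_right _ _), h⟩
    obtain ⟨π, hπ, hπe⟩ := exists_mem_basicGroup (a := a) (F := D) hmin
      (fun f hf => (hsep f hf).imp fun i hi => ⟨(hi.1.trans_le hnm).le, hi.2⟩)
      (fun f hf => (hsep f hf).imp fun i hi =>
        ⟨(hi.1.trans_le hnm).le, by rw [← hv i hi.1]; exact hi.2⟩)
    have hED : E ⊆ D := fun f hf =>
      Finset.mem_erase.2 ⟨fun h => heE (h ▸ hf), Finset.mem_union_left _ hf⟩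
    let ρ : group a := ⟨π, basicGroup_le_group _ _ hπ⟩
    have hρatom : ∀ f, ρ • atom (normalFilter a) (a f) = atom _ (a (coord a π f)) := fun f => by
      rw [smul_atom, ← induces_coord]
    have hρy : ρ • y ∈ Y := smul_mem_of_smul_eq
      (hE ρ (basicGroup_anti ((le_max_left _ _).trans hnm) hED hπ)) hy
    have hvy : atom _ (a v) ∉ y := by
      intro h
      obtain ⟨i, hi, h'⟩ := hsep v (Finset.mem_erase.2
        ⟨hve, Finset.mem_union_right _ (hD.mem_toFinset.2 h)⟩)
      exact h' (hv i hi).symm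
    have hvρ : atom _ (a v) ∈ ρ • y := by
      rw [← hπe, ← hρatom]
      exact (smul_mem_smul_iff ρ).2 hey
    have hne' : ρ • y ≠ y := fun h => hvy (h ▸ hvρ)
    -- Any other atom of `y` is fixed by `ρ` and so would lie in the two distinct members `y` and `ρ
    -- • y`.
    have hy1 : y = pair (atom _ (a e)) (atom _ (a e)) := by
      refine ext (hYS y hy).1.1 (isPair_pair _ _).1 fun z => ?_
      rw [mem_pair, or_self]
      refine ⟨fun hz => ?_, fun h => h ▸ hey⟩
      obtain ⟨f, rfl⟩ := (mem_atomSet_iff hS).1 ((hYS y hy).1.2 z hz)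
      by_contra hfe
      have hfD : f ∈ D := Finset.mem_erase.2
        ⟨fun h => hfe (h ▸ rfl), Finset.mem_union_right _ (hD.mem_toFinset.2 hz)⟩
      refine hdisj _ _ hρy hy hne' _ ⟨?_, hz⟩
      have h1 := (smul_mem_smul_iff ρ).2 hz
      rwa [hρatom, (mem_basicGroup_iff_coord.1 hπ).2.1 f hfD] at h1
    refine ⟨hy1, ?_⟩
    rwa [hy1, smul_pair, hρatom, hπe] at hρy
  refine ⟨e, max n l, fun v hv => ?_⟩
  by_cases hve : v = e
  -- For `e` itself, any other point of the ball serves to show that `y` is the singleton of its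
  -- atom.
  · have h := (hmove (Function.update e (max n l) (e (max n l) + 1))
      (fun i hi => by rw [Function.update_of_ne hi.ne])
      (fun h => by simpa using congrFun h (max n l))).1
    rwa [hve, ← h]
  · exact (hmove v hv hve).2

/-- A pair is the union of its two singletons; this makes the colour of pairs relevant to `Y`. -/
theorem isFiniteUnion_pair {Y x y : PermutationModel (normalFilter a)} (hx : pair x x ∈ Y)
    (hy : pair y y ∈ Y) : IsFiniteUnion (pair x y) Y := by
  refine ⟨pair (pair x x) (pair y y), ⟨(isPair_pair _ _).1, fun z hz => ?_⟩,
    isFinite_iff.2 ⟨(isPair_pair _ _).1, ?_⟩, fun h => h.2 _ (mem_pair.2 (.inl rfl)),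
    (isPair_pair _ _).1, fun z => ?_⟩
  · rcases mem_pair.1 hz with rfl | rfl
    exacts [hx, hy]
  · exact (Set.toFinite {pair x x, pair y y}).subset fun z hz => mem_pair.1 hz
  · simp only [mem_pair, exists_eq_or_imp, exists_eq_left, or_self]

theorem isHFinite_atomSet {S : PermutationModel (normalFilter a)} (hS : IsAtomSet S) :
    IsHFinite S := by
  classical
  obtain ⟨P, hP⟩ := exists_finitePowerSet S
  have hSsmul : ∀ π : group a, π • S = S := fun π =>
    ext ((isSet_smul_iff π).2 hS.1) hS.1 fun z => by
      rw [mem_smul_iff, hS.2, hS.2, isAtom_smul_iff]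
  obtain ⟨c, hc, hcm⟩ := exists_function (X := P) (Y := pair (nat 0) (nat 1))
    (fun p => if IsEvenPair p then nat 1 else nat 0)
    (fun p _ => by
      rw [mem_pair]
      split_ifs
      exacts [.inr rfl, .inl rfl]) (normalFilter a).self_mem
    (fun π _ p hp => by
      rw [hP.2] at hp ⊢
      rw [← hSsmul π]
      exact ⟨(isSubset_smul_iff π).2 hp.1, (isFinite_smul_iff π).2 hp.2⟩)
    (fun π _ p _ => by
      simp only [isEvenPair_smul_iff]
      split_ifs <;> rw [smul_nat])
  refine ⟨P, _, c, hP, isTwo_nat, hc, ?_⟩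
  rintro ⟨Y, hYP, hY, hdisj, i, -, hmono⟩
  obtain ⟨e, l, hball⟩ := exists_ball_of_disjoint hS (fun y hy => (hP.2 y).1 (hYP.2 y hy)) hY hdisj
  -- Changing `e` at place `k` alone gives a pair in the ball whose first difference is exactly `k`.
  have hcol : ∀ k, l ≤ k → i = if Even k then nat 1 else nat 0 := by
    intro k hk
    set v := Function.update e k (e k + 1)
    have hv : ∀ j < k, e j = v j := fun j hj => (Function.update_of_ne hj.ne _ _).symm
    have hvk : e k ≠ v k := by simp [v]
    have h := ((hcm _ _).1 (hmono _ (isFiniteUnion_pair (hball e fun _ _ => rfl)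
      (hball v fun j hj => hv j (hj.trans_le hk))))).2
    simpa only [isEvenPair_pair_iff hv hvk] using h
  have h0 := hcol (2 * l) (by omega)
  have h1 := hcol (2 * l + 1) (by omega)
  rw [if_pos (even_two_mul l)] at h0
  rw [if_neg (by simp [parity_simps])] at h1
  exact absurd (nat_injective (h0.symm.trans h1)) one_ne_zero

theorem not_hindman : ¬ HT (PermutationModel (normalFilter a)) := by
  intro h
  obtain ⟨S, hS⟩ := exists_atomSet (F := normalFilter a)
  obtain ⟨P, t, c, hP, ht, hc, hno⟩ := isHFinite_atomSet hS
  exact hno (h S (isInfinite_atomSet hS) P t c hP ht hc)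

end Baire

theorem mainTheorem2 {A : Type u} (a : (ℕ → ℕ) ≃ A) :
    (∀ X : IsometryModel a, Internal.IsInfinite X → Internal.IsCInfinite X) ∧
      Internal.Form82 (IsometryModel a) ∧
      (∃ S : IsometryModel a, Internal.IsAtomSet S ∧ Internal.IsInfinite S ∧ Internal.IsHFinite S) ∧
      ¬ Internal.HT (IsometryModel a) := by
  obtain ⟨S, hS⟩ := PermutationModel.exists_atomSet (F := Baire.normalFilter a)
  exact ⟨fun X hX => Baire.isCInfinite_of_isInfinite hX, Baire.form82,
    ⟨S, hS, Baire.isInfinite_atomSet hS, Baire.isHFinite_atomSet hS⟩, Baire.not_hindman⟩
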